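/- **Theorem (recovery by contrastive learning).** Let $1\le r\le d<n$. Let $U^\star\in\mathbb R^{d\times r}$ with $U^{\star\top}U^\star=I_r$, let $\nu>0$ and $\sigma_1,\dots,\sigma_d>0$, and let $x_i=U^\star z_i+\xi_i$ $(i=1,\dots,n)$, where the pairs $(z_i,\xi_i)\in\mathbb R^r\times\mathbb R^d$ are i.i.d., $z_i$ and $\xi_i$ are independent with mean zero, $\mathrm{Cov}(z_i)=\nu^2I_r$, $\mathrm{Cov}(\xi_i)=\mathrm{diag}(\sigma_1^2,\dots,\sigma_d^2)$, and both are sub-Gaussian: with $\sigma_{(1)}=\max_k\sigma_k$, $\sigma_{(d)}=\min_k\sigma_k$ and a constant $K$, $$\mathbb E e^{\langle u,z_i\rangle}\le e^{K\nu^2\|u\|^2/2}\ (u\in\mathbb R^r),\qquad \mathbb E e^{\langle u,\xi_i\rangle}\le e^{K\sigma_{(1)}^2\|u\|^2/2}\ (u\in\mathbb R^d).$$ Assume, for constants $C_\kappa,c_1,c_2,C_I$ with $c_1>0$: 1. $\sigma_{(1)}^2/\sigma_{(d)}^2<C_\kappa$; 2. $c_1\le\nu/\sigma_{(1)}\le c_2$;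 3. $\max_{k\le d}\|e_k^\top U^\star\|^2\le C_I\,\frac{r\log d}{d}$. For $\lambda>0$, $W\in\mathbb R^{r\times d}$ and maps $g_1,g_2:\mathbb R^d\to\mathbb R^d$, let $$\mathcal L_{g_1,g_2}(W)=-\frac1{2n}\sum_{i=1}^n\sum_{v=1}^2\Bigl[\langle Wg_v(x_i),Wg_{3-v}(x_i)\rangle-\sum_{j\ne i}\sum_{s=1}^2\frac{\langle Wg_v(x_i),Wg_s(x_j)\rangle}{2n-2}\Bigr]+\frac\lambda2\|WW^\top\|_F^2 ,$$ and let $\mathcal L(W)=\mathbb E_A\,\mathcal L_{A,\,I-A}(W)$ be the self-supervised contrastive loss under random masking, where $g_1(x)=Ax$, $g_2(x)=(I-A)x$, and $A=\mathrm{diag}(a_1,\dots,a_d)$ has i.i.d. Bernoulli$(1/2)$ entries $a_k$, independent of the data. Let $W_{\rm CL}\in\mathbb R^{r\times d}$ be any (data-dependent) global minimizer of $\mathcal L$, and let $W_{\rm CL}=(U_{\rm CL}\Sigma_{\rm CL}V_{\rm CL}^\top)^\top$ be any singular value decomposition, with $U_{\rm CL}\in\mathbb R^{d\times r}$ having orthonormal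 columns, $V_{\rm CL}\in\mathbb R^{r\times r}$ orthogonal and $\Sigma_{\rm CL}$ diagonal and nonnegative; $U_{\rm CL}$ is assumed to be a measurable function of the underlying randomness. Then $$\mathbb E\,\|\sin\Theta(U^\star,U_{\rm CL})\|_F\le C\Bigl(\frac{r^{3/2}}d\log d+\sqrt{\frac{dr}n}\Bigr),$$ where $C$ depends only on $C_\kappa,c_1,c_2,C_I,K$, and $\|\sin\Theta(U_1,U_2)\|_F=\|U_{1\perp}^\top U_2\|_F=\|(I-U_1U_1^\top)U_2\|_F$, where the columns of $U_{1\perp}$ are an orthonormal basis of the orthogonal complement of the column space of $U_1$. -/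

import Mathlib

open MeasureTheory ProbabilityTheory Matrix

namespace SpikedCL

noncomputable section

/-- The Frobenius norm of a real matrix. -/
def frobNorm {m n : ℕ} (A : Matrix (Fin m) (Fin n) ℝ) : ℝ :=
  Real.sqrt (∑ i, ∑ j, A i j ^ 2)

/-- `U` has orthonormal columns: `Uᵀ U = I_r`. -/
def IsOrthonormalCols {d r : ℕ} (U : Matrix (Fin d) (Fin r) ℝ) : Prop :=
  Uᵀ * U = 1

/-- The sine distance `‖sin Θ(U₁, U₂)‖_F = ‖U₁⊥ᵀ U₂‖_F` of two matrices with orthonormal columns.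
Since `U₁⊥ U₁⊥ᵀ = I - U₁ U₁ᵀ`, it is written without choosing a complement `U₁⊥`;
`sinTheta_eq_frobNorm_compl` shows that this is the same number for every complement. -/
def sinTheta {d r : ℕ} (U₁ U₂ : Matrix (Fin d) (Fin r) ℝ) : ℝ :=
  frobNorm ((1 - U₁ * U₁ᵀ) * U₂)

lemma sum_sq_eq_trace {m n : ℕ} (A : Matrix (Fin m) (Fin n) ℝ) :
    ∑ i, ∑ j, A i j ^ 2 = (Aᵀ * A).trace := by
  simp only [Matrix.trace, Matrix.diag_apply, Matrix.mul_apply, Matrix.transpose_apply]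
  rw [Finset.sum_comm]
  simp [sq]

lemma sinTheta_eq_frobNorm_compl {d r k : ℕ} (U₁ U₂ : Matrix (Fin d) (Fin r) ℝ)
    (Uperp : Matrix (Fin d) (Fin k) ℝ) (hk : r + k = d) (h₁ : IsOrthonormalCols U₁)
    (hp : IsOrthonormalCols Uperp) (h : U₁ᵀ * Uperp = 0) :
    sinTheta U₁ U₂ = frobNorm (Uperpᵀ * U₂) := by
  have h' : Uperpᵀ * U₁ = 0 := by
    have := congrArg Matrix.transpose h
    simpa [Matrix.transpose_mul] using this
  have hsum : U₁ * U₁ᵀ + Uperp * Uperpᵀ = 1 := by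
    have e : (fromCols U₁ Uperp)ᵀ * fromCols U₁ Uperp = 1 := by
      rw [transpose_fromCols, fromRows_mul_fromCols, h₁, hp, h, h', fromBlocks_one]
    have e2 := (Matrix.mul_eq_one_comm_of_card_eq _ _ _ (by simp [hk])).1 e
    rwa [transpose_fromCols, fromCols_mul_fromRows] at e2
  have hproj : (1 : Matrix (Fin d) (Fin d) ℝ) - U₁ * U₁ᵀ = Uperp * Uperpᵀ := by
    rw [← hsum]; abel
  unfold sinTheta frobNorm
  rw [sum_sq_eq_trace, sum_sq_eq_trace, hproj]
  congr 2
  simp only [Matrix.transpose_mul, Matrix.transpose_transpose, Matrix.mul_assoc]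
  rw [← Matrix.mul_assoc Uperpᵀ Uperp, hp, Matrix.one_mul]

/-- A singular value decomposition `W = (U Σ Vᵀ)ᵀ` of a matrix `W` of size `r × d`: the columns
of `U` (`d × r`) are right singular vectors of `W`, those of `V` (`r × r`) are left singular
vectors and `s` lists the `r` singular values (in any order). -/
structure IsSVD {d r : ℕ} (W : Matrix (Fin r) (Fin d) ℝ) (U : Matrix (Fin d) (Fin r) ℝ)
    (s : Fin r → ℝ) (V : Matrix (Fin r) (Fin r) ℝ) : Prop where
  orthonormal_right : IsOrthonormalCols U
  orthonormal_left : IsOrthonormalCols V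
  nonneg : ∀ i, 0 ≤ s i
  eq : W = (U * Matrix.diagonal s * Vᵀ)ᵀ

/-- The self-supervised contrastive loss of `W` on the data `x₁, …, xₙ`, for the augmentation
functions `g 0, g 1`. The positive partner of the view `g v (x i)` is the other view of `x i`;
its negative samples are both views of all the other data points. -/
def selfConLoss {n d r : ℕ} (lam : ℝ) (g : Fin 2 → (Fin d → ℝ) → (Fin d → ℝ))
    (x : Fin n → Fin d → ℝ) (W : Matrix (Fin r) (Fin d) ℝ) : ℝ :=
  -(1 / (2 * (n : ℝ))) *
      ∑ i, ∑ v, ((∑ s ∈ Finset.univ.erase v, (W *ᵥ g v (x i)) ⬝ᵥ (W *ᵥ g s (x i))) -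
        ∑ j ∈ Finset.univ.erase i, ∑ s,
          ((W *ᵥ g v (x i)) ⬝ᵥ (W *ᵥ g s (x j))) / (2 * (n : ℝ) - 2)) +
    lam / 2 * frobNorm (W * Wᵀ) ^ 2

/-- The masking matrix `A = diag(a₁, …, a_d)`, with `a_k ∈ {0, 1}` encoded by a Boolean. -/
def maskMatrix {d : ℕ} (a : Fin d → Bool) : Matrix (Fin d) (Fin d) ℝ :=
  Matrix.diagonal fun k => if a k then 1 else 0

/-- The two views `x ↦ A x` and `x ↦ (I - A) x`. -/
def maskViews {d : ℕ} (a : Fin d → Bool) : Fin 2 → (Fin d → ℝ) → (Fin d → ℝ) :=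
  ![fun x => maskMatrix a *ᵥ x, fun x => (1 - maskMatrix a) *ᵥ x]

/-- The law of the mask: i.i.d. Bernoulli coordinates with mean `1/2`. -/
def maskLaw (d : ℕ) : Measure (Fin d → Bool) :=
  Measure.pi fun _ => bernoulliMeasure true false ⟨1 / 2, by norm_num, by norm_num⟩

/-- The self-supervised contrastive loss under random masking: the expectation, over the random
mask (which is shared by all data points), of the contrastive loss. -/
def maskedLoss {n d r : ℕ} (lam : ℝ) (x : Fin n → Fin d → ℝ)
    (W : Matrix (Fin r) (Fin d) ℝ) : ℝ :=
  ∫ a, selfConLoss lam (maskViews a) x W ∂(maskLaw d)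

/-- `W` is a global minimizer of the random-masking contrastive loss on the data `x`. -/
def IsCLSolution {n d r : ℕ} (lam : ℝ) (x : Fin n → Fin d → ℝ)
    (W : Matrix (Fin r) (Fin d) ℝ) : Prop :=
  ∀ W' : Matrix (Fin r) (Fin d) ℝ, maskedLoss lam x W ≤ maskedLoss lam x W'

/-- The random vector `v` is (centred and) sub-Gaussian with variance proxy `c`: every linear form
`⟨u, v⟩` is sub-Gaussian with variance proxy `c ‖u‖²`. -/
def IsSubGaussianVec {Ω : Type*} [MeasurableSpace Ω] {m : ℕ} (μ : Measure Ω)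
    (v : Ω → Fin m → ℝ) (c : ℝ) : Prop :=
  ∀ u : Fin m → ℝ, HasSubgaussianMGF (fun ω => u ⬝ᵥ v ω) (c * (u ⬝ᵥ u)).toNNReal μ

/-- The largest noise level `σ_(1)`. -/
def sigmaMax {d : ℕ} (σ : Fin d → ℝ) : ℝ := ⨆ i, σ i

/-- The smallest noise level `σ_(d)`. -/
def sigmaMin {d : ℕ} (σ : Fin d → ℝ) : ℝ := ⨅ i, σ i

/-- The condition number `κ = σ_(1)² / σ_(d)²` of `Σ = diag(σ₁², …, σ_d²)`. -/
def condNumber {d : ℕ} (σ : Fin d → ℝ) : ℝ := sigmaMax σ ^ 2 / sigmaMin σ ^ 2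

/-- The signal to noise ratio `ρ = ν / σ_(1)`. -/
def snr {d : ℕ} (ν : ℝ) (σ : Fin d → ℝ) : ℝ := ν / sigmaMax σ

/-- The incoherence constant `I(U) = max_i ‖e_iᵀ U‖²`. -/
def incoherence {d r : ℕ} (U : Matrix (Fin d) (Fin r) ℝ) : ℝ := ⨆ i, ∑ j, U i j ^ 2

/-- `(z i, ξ i)`, `i = 1, …, n`, are the i.i.d. latent features and noise vectors of a sample from
the spiked covariance model `x = U⋆ z + ξ`, with `Cov(z) = ν² I_r`,
`Cov(ξ) = diag(σ₁², …, σ_d²)`, `z` and `ξ` centred, independent, and sub-Gaussian on the scales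
`ν` and `σ_(1)` with constant `K`. -/
structure IsSpikedSample {Ω : Type*} [MeasurableSpace Ω] {n d r : ℕ} (μ : Measure Ω) (K ν : ℝ)
    (σ : Fin d → ℝ) (z : Fin n → Ω → Fin r → ℝ) (ξ : Fin n → Ω → Fin d → ℝ) : Prop where
  measurable_z : ∀ i, Measurable (z i)
  measurable_noise : ∀ i, Measurable (ξ i)
  iIndep : iIndepFun (fun i ω => (z i ω, ξ i ω)) μ
  identDistrib : ∀ i j, IdentDistrib (fun ω => (z i ω, ξ i ω)) (fun ω => (z j ω, ξ j ω)) μ μ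
  indep : ∀ i, IndepFun (z i) (ξ i) μ
  mean_z : ∀ i a, ∫ ω, z i ω a ∂μ = 0
  mean_noise : ∀ i k, ∫ ω, ξ i ω k ∂μ = 0
  cov_z : ∀ i a b, covariance (fun ω => z i ω a) (fun ω => z i ω b) μ = if a = b then ν ^ 2 else 0
  cov_noise : ∀ i k l,
    covariance (fun ω => ξ i ω k) (fun ω => ξ i ω l) μ = if k = l then σ k ^ 2 else 0
  subGaussian_z : ∀ i, IsSubGaussianVec μ (z i) (K * ν ^ 2)
  subGaussian_noise : ∀ i, IsSubGaussianVec μ (ξ i) (K * sigmaMax σ ^ 2)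

/-- The observed data points `x i = U⋆ z i + ξ i`. -/
def observed {Ω : Type*} {n d r : ℕ} (Ustar : Matrix (Fin d) (Fin r) ℝ)
    (z : Fin n → Ω → Fin r → ℝ) (ξ : Fin n → Ω → Fin d → ℝ) (ω : Ω) : Fin n → Fin d → ℝ :=
  fun i => Ustar *ᵥ z i ω + ξ i ω

end

end SpikedCL

namespace SpikedCL

noncomputable section

/-! The mask enters the loss only through `a k * (1 - a l)`, whose mean is `1/4` off the diagonal
and `0` on it. The averaged loss is therefore a quartic in `W` driven by one symmetric matrix `M =
contrastMatrix x` (`maskedLoss_eq`). Masking deletes the diagonal of the second moment matrix, which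
is exactly where the heteroscedastic noise sits, so `M` is close to `ν² U⋆U⋆ᵀ`.

Deterministic half. The loss is invariant under orthogonal maps on the left, so by the SVD the rows
`s j • u j` form a minimizer too, and each row may be varied alone. Stationarity makes `u j` an
eigenvector with eigenvalue `4 λ (s j)²` when `s j ≠ 0`; comparison with an optimally scaled
competitor shows that this eigenvalue dominates every positive Rayleigh quotient of a unit vector
orthogonal to the other columns. The range of `U⋆` contains such a vector by a dimension count, so
the eigenvalue is at least `q - ε`, where `q = ν²` and `ε` bounds `M - q U⋆U⋆ᵀ`. Testing the
eigenvalue equation against the part of `u j` outside the range of `U⋆` bounds that part by `2ε/q`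
(`sinTheta_le_of_minimizer`).

Probabilistic half. An exact identity (`contrastMatrix_eq`) splits `M - q U⋆U⋆ᵀ` into the error of
the second moment matrix, its diagonal, the diagonal of `q U⋆U⋆ᵀ` (controlled by incoherence, giving
the `log d` term), and two terms of order `d/n`. The operator norm of the error has mean `O(√(d/n))`
at the noise scale, by a net and an exponential moment bound. The angle bound is linear in `ε` for
every realization, so expectations can be taken at once, without a good event. -/

/-- The matrix whose leading eigenspaces the masked contrastive loss recovers: the off-diagonal part
of the empirical second moment matrix, minus the average of `x i (x j)ᵀ` over distinct pairs. -/
def contrastMatrix {n d : ℕ} (x : Fin n → Fin d → ℝ) : Matrix (Fin d) (Fin d) ℝ :=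
  Matrix.of fun k l => (if k = l then 0 else (1 / (n : ℝ)) * ∑ i, x i k * x i l) -
    1 / ((n : ℝ) * ((n : ℝ) - 1)) * ∑ i, ∑ j ∈ Finset.univ.erase i, x i k * x j l

/-! ### Averaging the loss over the mask -/

instance isProbabilityMeasure_maskLaw (d : ℕ) : IsProbabilityMeasure (maskLaw d) := by
  unfold maskLaw; infer_instance

lemma integral_bernoulli_half (f : Bool → ℝ) :
    ∫ b, f b ∂(bernoulliMeasure true false ⟨1 / 2, by norm_num, by norm_num⟩) =
      (f true + f false) / 2 := by
  rw [integral_bernoulliMeasure]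
  simp only [smul_eq_mul]
  ring

/-- A coordinate never survives in both views, so the diagonal vanishes; off the diagonal the two
factors are independent with mean `1/2` each. This is the source of the diagonal deletion. -/
lemma integral_mask_mul_compl {d : ℕ} (k l : Fin d) :
    ∫ a, (if a k then (1 : ℝ) else 0) * (1 - if a l then (1 : ℝ) else 0) ∂(maskLaw d) =
      if k = l then 0 else 1 / 4 := by
  by_cases h : k = l
  · subst h
    have : ∀ a : Fin d → Bool,
        (if a k then (1 : ℝ) else 0) * (1 - if a k then (1 : ℝ) else 0) = 0 := by
      intro a; by_cases ha : a k <;> simp [ha]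
    simp [this]
  · let F : Fin d → Bool → ℝ := fun i b =>
      if i = k then (if b then 1 else 0) else if i = l then (1 - if b then 1 else 0) else 1
    have hF : ∀ a : Fin d → Bool,
        (if a k then (1 : ℝ) else 0) * (1 - if a l then (1 : ℝ) else 0) = ∏ i, F i (a i) := by
      intro a
      rw [← Finset.mul_prod_erase _ _ (Finset.mem_univ k),
        ← Finset.mul_prod_erase _ _ (Finset.mem_erase.2 ⟨Ne.symm h, Finset.mem_univ l⟩)]
      rw [Finset.prod_eq_one]
      · simp [F, Ne.symm h]
      · intro i hi
        simp only [Finset.mem_erase] at hi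
        simp [F, hi.1, hi.2.1]
    simp_rw [hF]
    unfold maskLaw
    rw [integral_fintype_prod_eq_prod]
    simp_rw [integral_bernoulli_half]
    rw [← Finset.mul_prod_erase _ _ (Finset.mem_univ k),
        ← Finset.mul_prod_erase _ _ (Finset.mem_erase.2 ⟨Ne.symm h, Finset.mem_univ l⟩)]
    rw [Finset.prod_eq_one]
    · simp [F, Ne.symm h, h]; norm_num
    · intro i hi
      simp only [Finset.mem_erase] at hi
      simp [F, hi.1, hi.2.1]

lemma mulVec_dotProduct_mulVec {m d : ℕ} (W : Matrix (Fin m) (Fin d) ℝ) (y y' : Fin d → ℝ) :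
    (W *ᵥ y) ⬝ᵥ (W *ᵥ y') = ∑ k, ∑ l, (Wᵀ * W) k l * (y k * y' l) := by
  rw [Matrix.dotProduct_mulVec, ← Matrix.mulVec_transpose, Matrix.mulVec_mulVec]
  simp only [dotProduct, mulVec, Finset.sum_mul]
  rw [Finset.sum_comm]
  refine Finset.sum_congr rfl fun k _ => Finset.sum_congr rfl fun l _ => ?_
  have : (Wᵀ * W) l k = (Wᵀ * W) k l := by
    simp [Matrix.mul_apply, mul_comm]
  rw [this]; ring

/-- The two views of a point add up to the point, so the negative samples, summed over both views on
both sides, no longer see the mask. The positive pair occurs twice by symmetry. -/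
lemma selfConLoss_maskViews {n d r : ℕ} (lam : ℝ) (a : Fin d → Bool) (x : Fin n → Fin d → ℝ)
    (W : Matrix (Fin r) (Fin d) ℝ) :
    selfConLoss lam (maskViews a) x W =
      -(1 / (2 * (n : ℝ))) * ∑ i, (2 * ∑ k, ∑ l, (Wᵀ * W) k l * (x i k * x i l) *
        ((if a k then (1 : ℝ) else 0) * (1 - if a l then (1 : ℝ) else 0)) -
        ∑ j ∈ Finset.univ.erase i, ((W *ᵥ x i) ⬝ᵥ (W *ᵥ x j)) / (2 * (n : ℝ) - 2)) +
      lam / 2 * frobNorm (W * Wᵀ) ^ 2 := by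
  unfold selfConLoss
  congr 2
  refine Finset.sum_congr rfl fun i _ => ?_
  have hsum : ∀ y : Fin d → ℝ, maskViews a 0 y + maskViews a 1 y = y := by
    intro y
    simp only [maskViews, Matrix.cons_val_zero, Matrix.cons_val_one]
    rw [← Matrix.add_mulVec]; simp
  have e0 : (Finset.univ.erase (0 : Fin 2)) = {1} := by decide
  have e1 : (Finset.univ.erase (1 : Fin 2)) = {0} := by decide
  rw [Finset.sum_sub_distrib]
  congr 1
  · rw [Fin.sum_univ_two, e0, e1, Finset.sum_singleton, Finset.sum_singleton,
      dotProduct_comm (W *ᵥ maskViews a 1 (x i)), ← two_mul, mulVec_dotProduct_mulVec]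
    congr 1
    refine Finset.sum_congr rfl fun k _ => Finset.sum_congr rfl fun l _ => ?_
    have h0 : maskViews a 0 (x i) k = (if a k then (1 : ℝ) else 0) * x i k := by
      simp [maskViews, maskMatrix, Matrix.mulVec_diagonal]
    have h1 : maskViews a 1 (x i) l = (1 - if a l then (1 : ℝ) else 0) * x i l := by
      simp only [maskViews, maskMatrix, Matrix.cons_val_one, Matrix.sub_mulVec,
        Matrix.one_mulVec, Pi.sub_apply, Matrix.mulVec_diagonal, Matrix.cons_val_fin_one]
      ring
    rw [h0, h1]; ring
  · rw [Finset.sum_comm]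
    refine Finset.sum_congr rfl fun j _ => ?_
    simp only [← Finset.sum_div]
    congr 1
    simp only [← dotProduct_sum, ← sum_dotProduct, Fin.sum_univ_two, ← Matrix.mulVec_add, hsum]

lemma sum_dotProduct_row {r d : ℕ} (W : Matrix (Fin r) (Fin d) ℝ) (M : Matrix (Fin d) (Fin d) ℝ) :
    ∑ a, W a ⬝ᵥ (M *ᵥ W a) = ∑ k, ∑ l, (Wᵀ * W) k l * M k l := by
  simp only [dotProduct, mulVec, Matrix.mul_apply, Matrix.transpose_apply, Finset.mul_sum,
    Finset.sum_mul]
  rw [Finset.sum_comm]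
  refine Finset.sum_congr rfl fun k _ => ?_
  rw [Finset.sum_comm]
  exact Finset.sum_congr rfl fun l _ => Finset.sum_congr rfl fun a _ => by ring

/-- Positive pairs carry the weight `(1/2n) * 2 * (1/4) = 1/(4n)` and negative pairs `(1/2n) *
1/(2n-2) = 1/(4n(n-1))`, so a common factor `1/4` comes out. -/
lemma maskedLoss_eq {n d r : ℕ} (hn : 2 ≤ n) (lam : ℝ) (x : Fin n → Fin d → ℝ)
    (W : Matrix (Fin r) (Fin d) ℝ) :
    maskedLoss lam x W = -(1 / 4) * ∑ a, W a ⬝ᵥ (contrastMatrix x *ᵥ W a) +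
      lam / 2 * frobNorm (W * Wᵀ) ^ 2 := by
  unfold maskedLoss
  simp_rw [selfConLoss_maskViews]
  rw [integral_add .of_finite .of_finite, integral_const_mul,
    integral_finsetSum _ fun _ _ => .of_finite]
  have hi : ∀ i, ∫ a, (2 * ∑ k, ∑ l, (Wᵀ * W) k l * (x i k * x i l) *
        ((if a k then (1 : ℝ) else 0) * (1 - if a l then (1 : ℝ) else 0)) -
        ∑ j ∈ Finset.univ.erase i, ((W *ᵥ x i) ⬝ᵥ (W *ᵥ x j)) / (2 * (n : ℝ) - 2)) ∂(maskLaw d) =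
      ∑ k, ∑ l, (Wᵀ * W) k l * (2 * (x i k * x i l) * (if k = l then 0 else 1 / 4) -
        ∑ j ∈ Finset.univ.erase i, x i k * x j l / (2 * (n : ℝ) - 2)) := by
    intro i
    rw [integral_sub .of_finite .of_finite, integral_const_mul,
      integral_finsetSum _ fun _ _ => .of_finite]
    simp_rw [integral_finsetSum _ fun _ _ => Integrable.of_finite, integral_const_mul,
      integral_mask_mul_compl, integral_const, probReal_univ, one_smul, mulVec_dotProduct_mulVec,
      mul_sub, Finset.sum_sub_distrib, Finset.mul_sum, Finset.sum_div]
    congr 1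
    · exact Finset.sum_congr rfl fun k _ => Finset.sum_congr rfl fun l _ => by ring
    · rw [Finset.sum_comm]
      refine Finset.sum_congr rfl fun k _ => ?_
      rw [Finset.sum_comm]
      exact Finset.sum_congr rfl fun l _ => Finset.sum_congr rfl fun j _ => by ring
  simp_rw [hi]
  rw [sum_dotProduct_row, integral_const, probReal_univ, one_smul]
  congr 1
  rw [Finset.sum_comm, Finset.mul_sum, Finset.mul_sum]
  refine Finset.sum_congr rfl fun k _ => ?_
  rw [Finset.sum_comm, Finset.mul_sum, Finset.mul_sum]
  refine Finset.sum_congr rfl fun l _ => ?_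
  have hn0 : (n : ℝ) ≠ 0 := by positivity
  have hn1 : (n : ℝ) - 1 ≠ 0 := by
    have : (2 : ℝ) ≤ n := by exact_mod_cast hn
    linarith
  rw [← Finset.mul_sum, Finset.sum_sub_distrib]
  simp only [contrastMatrix, Matrix.of_apply, ← Finset.sum_div, ← Finset.sum_mul, ← Finset.mul_sum]
  have h2 : 2 * (n : ℝ) - 2 = 2 * ((n : ℝ) - 1) := by ring
  rw [h2]
  split_ifs <;> field_simp <;> ring

/-! ### Minimizers of the quartic loss -/

lemma frobNorm_sq {m n : ℕ} (A : Matrix (Fin m) (Fin n) ℝ) :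
    frobNorm A ^ 2 = ∑ i, ∑ j, A i j ^ 2 :=
  Real.sq_sqrt (Finset.sum_nonneg fun _ _ => Finset.sum_nonneg fun _ _ => sq_nonneg _)

lemma frobNorm_mul_transpose_sq {m n : ℕ} (W : Matrix (Fin m) (Fin n) ℝ) :
    frobNorm (W * Wᵀ) ^ 2 = frobNorm (Wᵀ * W) ^ 2 := by
  rw [frobNorm_sq, frobNorm_sq, sum_sq_eq_trace, sum_sq_eq_trace]
  simp only [Matrix.transpose_mul, Matrix.transpose_transpose, Matrix.mul_assoc]
  rw [Matrix.trace_mul_comm]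
  simp only [Matrix.mul_assoc]

/-- The quartic objective to which the masked contrastive loss reduces. -/
def quarticLoss {d r : ℕ} (lam : ℝ) (M : Matrix (Fin d) (Fin d) ℝ)
    (W : Matrix (Fin r) (Fin d) ℝ) : ℝ :=
  -(1 / 4) * ∑ a, W a ⬝ᵥ (M *ᵥ W a) + lam / 2 * frobNorm (W * Wᵀ) ^ 2

/-- Both terms depend on the argument only through its Gram matrix `Yᵀ * Y`. This lets the factor
`V` of the SVD be dropped. -/
lemma quarticLoss_orthonormal_mul {d r : ℕ} (lam : ℝ) (M : Matrix (Fin d) (Fin d) ℝ)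
    (V : Matrix (Fin r) (Fin r) ℝ) (hV : IsOrthonormalCols V) (Y : Matrix (Fin r) (Fin d) ℝ) :
    quarticLoss lam M (V * Y) = quarticLoss lam M Y := by
  have h : (V * Y)ᵀ * (V * Y) = Yᵀ * Y := by
    rw [Matrix.transpose_mul, Matrix.mul_assoc, ← Matrix.mul_assoc Vᵀ, hV, Matrix.one_mul]
  unfold quarticLoss
  rw [frobNorm_mul_transpose_sq, frobNorm_mul_transpose_sq, sum_dotProduct_row,
    sum_dotProduct_row, h]

/-- The part of `quarticLoss` that depends on one row `y`, the other rows being `Y`. -/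
def rowLoss {d r : ℕ} (lam : ℝ) (M : Matrix (Fin d) (Fin d) ℝ) (Y : Fin r → Fin d → ℝ)
    (j : Fin r) (y : Fin d → ℝ) : ℝ :=
  -(1 / 4) * (y ⬝ᵥ (M *ᵥ y)) +
    lam / 2 * ((y ⬝ᵥ y) ^ 2 + 2 * ∑ i ∈ Finset.univ.erase j, (Y i ⬝ᵥ y) ^ 2)

/-- Separates what one row can influence from a constant; the factor `2` in `rowLoss` counts each
off-diagonal Gram entry of row `j` in both positions. -/
lemma quarticLoss_update {d r : ℕ} (lam : ℝ) (M : Matrix (Fin d) (Fin d) ℝ)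
    (Y : Fin r → Fin d → ℝ) (j : Fin r) (y : Fin d → ℝ) :
    quarticLoss lam M (Matrix.of (Function.update Y j y)) = rowLoss lam M Y j y +
      (-(1 / 4) * ∑ i ∈ Finset.univ.erase j, Y i ⬝ᵥ (M *ᵥ Y i) + lam / 2 *
        ∑ i ∈ Finset.univ.erase j, ∑ k ∈ Finset.univ.erase j, (Y i ⬝ᵥ Y k) ^ 2) := by
  unfold quarticLoss rowLoss
  rw [frobNorm_sq]
  have e : ∀ i k, ((Matrix.of (Function.update Y j y)) * (Matrix.of (Function.update Y j y))ᵀ) i k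
      = Function.update Y j y i ⬝ᵥ Function.update Y j y k := fun i k => rfl
  have e' : ∀ i, (Matrix.of (Function.update Y j y)) i = Function.update Y j y i := fun i => rfl
  have hne : ∀ i ∈ Finset.univ.erase j, Function.update Y j y i = Y i := fun i hi =>
    Function.update_of_ne (Finset.ne_of_mem_erase hi) _ _
  simp_rw [e, e', ← Finset.add_sum_erase _ _ (Finset.mem_univ j), Function.update_self]
  have h1 : ∑ i ∈ Finset.univ.erase j, Function.update Y j y i ⬝ᵥ M *ᵥ Function.update Y j y i
      = ∑ i ∈ Finset.univ.erase j, Y i ⬝ᵥ M *ᵥ Y i :=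
    Finset.sum_congr rfl fun i hi => by rw [hne i hi]
  have h2 : ∑ i ∈ Finset.univ.erase j, (y ⬝ᵥ Function.update Y j y i) ^ 2 =
      ∑ i ∈ Finset.univ.erase j, (Y i ⬝ᵥ y) ^ 2 :=
    Finset.sum_congr rfl fun i hi => by rw [hne i hi, dotProduct_comm]
  have h3 : ∑ i ∈ Finset.univ.erase j, ((Function.update Y j y i ⬝ᵥ y) ^ 2 +
        ∑ k ∈ Finset.univ.erase j, (Function.update Y j y i ⬝ᵥ Function.update Y j y k) ^ 2) =
      ∑ i ∈ Finset.univ.erase j, (Y i ⬝ᵥ y) ^ 2 +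
        ∑ i ∈ Finset.univ.erase j, ∑ k ∈ Finset.univ.erase j, (Y i ⬝ᵥ Y k) ^ 2 := by
    rw [← Finset.sum_add_distrib]
    refine Finset.sum_congr rfl fun i hi => ?_
    rw [hne i hi]
    congr 1
    exact Finset.sum_congr rfl fun k hk => by rw [hne k hk]
  rw [h1, h2, h3]
  ring

/-- With `V` removed, the matrix with rows `s i • Uᵀ i` is again a minimizer, so changing only its
row `j` cannot lower the loss. -/
lemma rowLoss_le_of_minimizer {d r : ℕ} {lam : ℝ} {M : Matrix (Fin d) (Fin d) ℝ}
    {W : Matrix (Fin r) (Fin d) ℝ} {U : Matrix (Fin d) (Fin r) ℝ} {s : Fin r → ℝ}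
    {V : Matrix (Fin r) (Fin r) ℝ}
    (hW : ∀ W' : Matrix (Fin r) (Fin d) ℝ, quarticLoss lam M W ≤ quarticLoss lam M W')
    (h : IsSVD W U s V) (j : Fin r) (y : Fin d → ℝ) :
    rowLoss lam M (fun i => s i • Uᵀ i) j (s j • Uᵀ j) ≤
      rowLoss lam M (fun i => s i • Uᵀ i) j y := by
  set Y : Fin r → Fin d → ℝ := fun i => s i • Uᵀ i with hY
  have h0 : W = V * Matrix.of (Function.update Y j (s j • Uᵀ j)) := by
    have : Function.update Y j (s j • Uᵀ j) = Y := Function.update_eq_self j Y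
    rw [this, h.eq, Matrix.transpose_mul, Matrix.transpose_mul, Matrix.transpose_transpose,
      Matrix.diagonal_transpose]
    congr 1
    ext i k
    simp [hY, Matrix.diagonal_mul]
  have h1 := hW (V * Matrix.of (Function.update Y j y))
  rw [h0, quarticLoss_orthonormal_mul _ _ _ h.orthonormal_left,
    quarticLoss_orthonormal_mul _ _ _ h.orthonormal_left, quarticLoss_update,
    quarticLoss_update] at h1
  linarith

lemma linear_coeff_eq_zero_of_nonneg {a b c e : ℝ}
    (h : ∀ t : ℝ, 0 ≤ a * t + b * t ^ 2 + c * t ^ 3 + e * t ^ 4) : a = 0 := by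
  have hd : HasDerivAt (fun t : ℝ => a * t + b * t ^ 2 + c * t ^ 3 + e * t ^ 4) a 0 := by
    have := (((hasDerivAt_id (0 : ℝ)).const_mul a).add
      (((hasDerivAt_id (0 : ℝ)).pow 2).const_mul b)).add
      (((hasDerivAt_id (0 : ℝ)).pow 3).const_mul c) |>.add
      (((hasDerivAt_id (0 : ℝ)).pow 4).const_mul e)
    exact this.congr_deriv (by simp)
  exact IsLocalMin.hasDerivAt_eq_zero (Filter.Eventually.of_forall fun t => by simpa using h t) hd

lemma IsOrthonormalCols.dotProduct_eq {d r : ℕ} {U : Matrix (Fin d) (Fin r) ℝ}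
    (hU : IsOrthonormalCols U) (i j : Fin r) : Uᵀ i ⬝ᵥ Uᵀ j = if i = j then 1 else 0 := by
  have := congrFun (congrFun hU i) j
  rwa [Matrix.one_apply] at this

/-- The columns of `U` with nonzero singular value are eigenvectors. -/
lemma mulVec_eq_of_minimizer {d r : ℕ} {lam : ℝ} {M : Matrix (Fin d) (Fin d) ℝ} (hM : Mᵀ = M)
    {W : Matrix (Fin r) (Fin d) ℝ} {U : Matrix (Fin d) (Fin r) ℝ} {s : Fin r → ℝ}
    {V : Matrix (Fin r) (Fin r) ℝ}
    (hW : ∀ W' : Matrix (Fin r) (Fin d) ℝ, quarticLoss lam M W ≤ quarticLoss lam M W')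
    (h : IsSVD W U s V) (j : Fin r) (hs : s j ≠ 0) (p : Fin d → ℝ) :
    p ⬝ᵥ (M *ᵥ Uᵀ j) = 4 * lam * s j ^ 2 * (p ⬝ᵥ Uᵀ j) := by
  have horth := h.orthonormal_right.dotProduct_eq
  have hsym : Uᵀ j ⬝ᵥ (M *ᵥ p) = p ⬝ᵥ (M *ᵥ Uᵀ j) := by
    rw [Matrix.dotProduct_mulVec, ← Matrix.mulVec_transpose, hM, dotProduct_comm]
  have key : -(1 / 2) * s j * (p ⬝ᵥ (M *ᵥ Uᵀ j)) + 2 * lam * s j ^ 3 * (p ⬝ᵥ Uᵀ j) = 0 := by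
    -- The coefficients are those of `rowLoss` along `s j • Uᵀ j + t • p`; the linear one is the
    -- stationarity condition, and orthonormality removes the other rows from it.
    refine linear_coeff_eq_zero_of_nonneg
      (b := -(1 / 4) * (p ⬝ᵥ (M *ᵥ p)) + lam * s j ^ 2 * (p ⬝ᵥ p) +
        2 * lam * s j ^ 2 * (p ⬝ᵥ Uᵀ j) ^ 2 +
        lam * ∑ i ∈ Finset.univ.erase j, (s i * (Uᵀ i ⬝ᵥ p)) ^ 2)
      (c := 2 * lam * s j * (p ⬝ᵥ Uᵀ j) * (p ⬝ᵥ p)) (e := lam / 2 * (p ⬝ᵥ p) ^ 2) fun t => ?_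
    have h1 := rowLoss_le_of_minimizer hW h j (s j • Uᵀ j + t • p)
    unfold rowLoss at h1
    simp only [Matrix.mulVec_add, Matrix.mulVec_smul, dotProduct_add, add_dotProduct,
      smul_dotProduct, dotProduct_smul, smul_eq_mul, hsym, horth] at h1
    have e1 : ∑ i ∈ Finset.univ.erase j, (s j * (s i * if i = j then (1 : ℝ) else 0)) ^ 2 = 0 :=
      Finset.sum_eq_zero fun i hi => by simp [Finset.ne_of_mem_erase hi]
    have e2 : ∑ i ∈ Finset.univ.erase j, (s j * (s i * if i = j then (1 : ℝ) else 0) +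
        t * (s i * Uᵀ i ⬝ᵥ p)) ^ 2 =
        t ^ 2 * ∑ i ∈ Finset.univ.erase j, (s i * (Uᵀ i ⬝ᵥ p)) ^ 2 := by
      rw [Finset.mul_sum]
      exact Finset.sum_congr rfl fun i hi => by simp [Finset.ne_of_mem_erase hi]; ring
    rw [e1, e2] at h1
    have e3 : Uᵀ j ⬝ᵥ p = p ⬝ᵥ Uᵀ j := dotProduct_comm _ _
    simp only [e3, if_true] at h1
    linarith
  have : s j * (p ⬝ᵥ (M *ᵥ Uᵀ j) - 4 * lam * s j ^ 2 * (p ⬝ᵥ Uᵀ j)) = 0 := by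
    linear_combination (-2) * key
  have := (mul_eq_zero.1 this).resolve_left hs
  linarith

/-- Each of the eigenvalues is at least the Rayleigh quotient of any unit vector orthogonal
to the other columns of `U`. -/
lemma rayleigh_le_of_minimizer {d r : ℕ} {lam : ℝ} (hlam : 0 < lam)
    {M : Matrix (Fin d) (Fin d) ℝ} (hM : Mᵀ = M)
    {W : Matrix (Fin r) (Fin d) ℝ} {U : Matrix (Fin d) (Fin r) ℝ} {s : Fin r → ℝ}
    {V : Matrix (Fin r) (Fin r) ℝ}
    (hW : ∀ W' : Matrix (Fin r) (Fin d) ℝ, quarticLoss lam M W ≤ quarticLoss lam M W')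
    (h : IsSVD W U s V) (j : Fin r) {w : Fin d → ℝ} (hw : w ⬝ᵥ w = 1)
    (hwu : ∀ i, i ≠ j → Uᵀ i ⬝ᵥ w = 0) (hpos : 0 < w ⬝ᵥ (M *ᵥ w)) :
    s j ≠ 0 ∧ w ⬝ᵥ (M *ᵥ w) ≤ 4 * lam * s j ^ 2 := by
  set τ := w ⬝ᵥ (M *ᵥ w)
  have horth := h.orthonormal_right.dotProduct_eq
  -- The scale `t² = τ / (4λ)` minimizes `-τ t² / 4 + λ t⁴ / 2`, with minimum `-τ² / (32λ)`.
  have h1 := rowLoss_le_of_minimizer hW h j (Real.sqrt (τ / (4 * lam)) • w)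
  unfold rowLoss at h1
  simp only [Matrix.mulVec_smul, smul_dotProduct, dotProduct_smul, smul_eq_mul, hw] at h1
  have e1 : ∑ i ∈ Finset.univ.erase j, (s j * (s i * Uᵀ i ⬝ᵥ Uᵀ j)) ^ 2 = 0 :=
    Finset.sum_eq_zero fun i hi => by simp [horth, Finset.ne_of_mem_erase hi]
  have e2 : ∑ i ∈ Finset.univ.erase j, (√(τ / (4 * lam)) * (s i * Uᵀ i ⬝ᵥ w)) ^ 2 = 0 :=
    Finset.sum_eq_zero fun i hi => by simp [hwu i (Finset.ne_of_mem_erase hi)]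
  have e3 : √(τ / (4 * lam)) * √(τ / (4 * lam)) = τ / (4 * lam) :=
    Real.mul_self_sqrt (by positivity)
  have h2 : -(1 / 4) * (s j ^ 2 * (Uᵀ j ⬝ᵥ (M *ᵥ Uᵀ j))) + lam / 2 * s j ^ 4 ≤
      -(τ ^ 2 / (32 * lam)) := by
    rw [e1, e2, horth] at h1
    have : -(1 / 4) * (√(τ / (4 * lam)) * (√(τ / (4 * lam)) * τ)) + lam / 2 *
        ((√(τ / (4 * lam)) * (√(τ / (4 * lam)) * 1)) ^ 2 + 2 * 0) = -(τ ^ 2 / (32 * lam)) := by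
      rw [mul_one, ← mul_assoc √(τ / (4 * lam)), e3]
      field_simp; ring
    rw [this] at h1
    simp only [if_true] at h1
    linarith
  have hτ : 0 < τ ^ 2 / (32 * lam) := by positivity
  have hs : s j ≠ 0 := by
    intro h0
    rw [h0] at h2
    norm_num at h2
    linarith
  refine ⟨hs, ?_⟩
  -- By the eigenvalue equation the row itself contributes `-λ (s j)⁴ / 2`, which turns the
  -- comparison into `τ² ≤ (4 λ (s j)²)²`.
  rw [mulVec_eq_of_minimizer hM hW h j hs, horth, if_pos rfl] at h2
  have h3 : τ ^ 2 / (32 * lam) ≤ lam / 2 * s j ^ 4 := by linarith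
  rw [div_le_iff₀ (by positivity)] at h3
  refine abs_le_of_sq_le_sq' ?_ (by positivity) |>.2
  nlinarith

/-- There are `r - 1` linear conditions on an `r`-dimensional space. Zeroing row `j` of `U₂ᵀ * U₁`
makes it singular, and a normalized kernel vector is the witness. -/
lemma exists_unit_orthogonal {d r : ℕ} (U₁ U₂ : Matrix (Fin d) (Fin r) ℝ)
    (h₁ : IsOrthonormalCols U₁) (j : Fin r) :
    ∃ c : Fin r → ℝ, (U₁ *ᵥ c) ⬝ᵥ (U₁ *ᵥ c) = 1 ∧ ∀ i, i ≠ j → U₂ᵀ i ⬝ᵥ (U₁ *ᵥ c) = 0 := by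
  obtain ⟨c, hc, hN⟩ := Matrix.exists_mulVec_eq_zero_iff.2
    (Matrix.det_eq_zero_of_row_eq_zero (A := (U₂ᵀ * U₁).updateRow j 0) j (by simp))
  have hU : ∀ c : Fin r → ℝ, (U₁ *ᵥ c) ⬝ᵥ (U₁ *ᵥ c) = c ⬝ᵥ c := by
    intro c
    rw [Matrix.dotProduct_mulVec, ← Matrix.mulVec_transpose, Matrix.mulVec_mulVec, h₁,
      Matrix.one_mulVec]
  have hcc : 0 < c ⬝ᵥ c := by
    refine lt_of_le_of_ne (Finset.sum_nonneg fun i _ => mul_self_nonneg _) fun h => hc ?_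
    exact dotProduct_self_eq_zero.1 h.symm
  refine ⟨(√(c ⬝ᵥ c))⁻¹ • c, ?_, fun i hi => ?_⟩
  · rw [hU, smul_dotProduct, dotProduct_smul, smul_eq_mul, smul_eq_mul, ← mul_assoc, ← mul_inv,
      Real.mul_self_sqrt hcc.le, inv_mul_cancel₀ hcc.ne']
  · have := congrFun hN i
    rw [Matrix.mulVec_smul, dotProduct_smul]
    have h2 : ((U₂ᵀ * U₁).updateRow j 0 *ᵥ c) i = U₂ᵀ i ⬝ᵥ (U₁ *ᵥ c) := by
      have h3 : U₂ᵀ i ⬝ᵥ (U₁ *ᵥ c) = ((U₂ᵀ * U₁) *ᵥ c) i := by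
        rw [← Matrix.mulVec_mulVec]; rfl
      rw [h3]
      simp only [mulVec, Matrix.updateRow_ne hi]
    rw [← h2, this]; simp

/-- A Davis–Kahan type bound for the minimizers of the quartic loss of a perturbation of a multiple
of a projection. -/
lemma sinTheta_le_of_minimizer {d r : ℕ} {lam q ε : ℝ} (hlam : 0 < lam) (hq : 0 < q) (hε : 0 ≤ ε)
    {M : Matrix (Fin d) (Fin d) ℝ} (hM : Mᵀ = M) {Us : Matrix (Fin d) (Fin r) ℝ}
    (hUs : IsOrthonormalCols Us)
    (hE : ∀ u v, u ⬝ᵥ ((M - q • (Us * Usᵀ)) *ᵥ v) ≤ ε * (√(u ⬝ᵥ u) * √(v ⬝ᵥ v)))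
    {W : Matrix (Fin r) (Fin d) ℝ} {U : Matrix (Fin d) (Fin r) ℝ} {s : Fin r → ℝ}
    {V : Matrix (Fin r) (Fin r) ℝ}
    (hW : ∀ W' : Matrix (Fin r) (Fin d) ℝ, quarticLoss lam M W ≤ quarticLoss lam M W')
    (h : IsSVD W U s V) :
    sinTheta Us U ≤ √r * (2 * ε / q) := by
  set P := Us * Usᵀ with hP
  have horth := h.orthonormal_right.dotProduct_eq
  have hPP : P * P = P := by
    rw [hP, Matrix.mul_assoc, ← Matrix.mul_assoc Usᵀ, hUs, Matrix.one_mul]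
  have hPt : Pᵀ = P := by rw [hP]; simp
  have hQ : (1 - P)ᵀ * (1 - P) = 1 - P := by
    rw [Matrix.transpose_sub, hPt, Matrix.transpose_one, Matrix.sub_mul, Matrix.one_mul,
      Matrix.mul_sub, hPP, Matrix.mul_one, sub_self, sub_zero]
  have hMeq : M = q • P + (M - q • P) := by abel
  have hpp : ∀ v, ((1 - P) *ᵥ v) ⬝ᵥ ((1 - P) *ᵥ v) = ((1 - P) *ᵥ v) ⬝ᵥ v := by
    intro v
    conv_lhs => rw [Matrix.dotProduct_mulVec, ← Matrix.mulVec_transpose, Matrix.mulVec_mulVec, hQ]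
  have hnn : ∀ v : Fin d → ℝ, 0 ≤ v ⬝ᵥ v := fun v => Finset.sum_nonneg fun i _ => mul_self_nonneg _
  have hcol : ∀ j, ((1 - P) *ᵥ Uᵀ j) ⬝ᵥ ((1 - P) *ᵥ Uᵀ j) ≤ (2 * ε / q) ^ 2 := by
    intro j
    set p := (1 - P) *ᵥ Uᵀ j with hp
    -- For a large perturbation the claimed bound is at least `1`, and a projection of a unit vector
    -- has norm at most `1`.
    by_cases hεq : q / 2 ≤ ε
    · have h1 : p ⬝ᵥ p ≤ 1 := by
        have hsplit : Uᵀ j = p + P *ᵥ Uᵀ j := by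
          rw [hp, Matrix.sub_mulVec, Matrix.one_mulVec]; abel
        have hz : p ⬝ᵥ (P *ᵥ Uᵀ j) = 0 := by
          rw [Matrix.dotProduct_mulVec, ← Matrix.mulVec_transpose, hPt, hp, Matrix.mulVec_mulVec,
            Matrix.mul_sub, hPP]
          simp
        have h1 : Uᵀ j ⬝ᵥ Uᵀ j = 1 := by rw [horth, if_pos rfl]
        rw [hsplit, add_dotProduct, dotProduct_add, dotProduct_add, hz,
          dotProduct_comm (P *ᵥ Uᵀ j) p, hz] at h1
        have := hnn (P *ᵥ Uᵀ j)
        linarith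
      refine h1.trans (one_le_pow₀ ?_)
      rw [one_le_div hq]; linarith
    · push Not at hεq
      obtain ⟨c, hw1, hw2⟩ := exists_unit_orthogonal Us U hUs j
      set w := Us *ᵥ c with hw
      have hPw : P *ᵥ w = w := by
        rw [hw, hP, Matrix.mulVec_mulVec, Matrix.mul_assoc, hUs, Matrix.mul_one]
      have hray : q - ε ≤ w ⬝ᵥ (M *ᵥ w) := by
        have h1 := hE (-w) w
        rw [neg_dotProduct, neg_dotProduct, dotProduct_neg, neg_neg, hw1, Real.sqrt_one] at h1
        rw [hMeq, Matrix.add_mulVec, Matrix.smul_mulVec, hPw, dotProduct_add, dotProduct_smul, hw1,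
          smul_eq_mul]
        linarith
      obtain ⟨hs, hmu⟩ := rayleigh_le_of_minimizer hlam hM hW h j hw1 hw2 (by linarith)
      have h2 := mulVec_eq_of_minimizer hM hW h j hs p
      have hz : p ⬝ᵥ (P *ᵥ Uᵀ j) = 0 := by
        rw [Matrix.dotProduct_mulVec, ← Matrix.mulVec_transpose, hPt, hp, Matrix.mulVec_mulVec,
          Matrix.mul_sub, hPP]
        simp
      -- Since `p` is orthogonal to the range of `P`, only the perturbation survives in `p ⬝ᵥ (M *ᵥ
      -- Uᵀ j)`. The eigenvalue exceeds `q / 2` because it is at least `q - ε`.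
      have h3 := hE p (Uᵀ j)
      rw [horth, if_pos rfl, Real.sqrt_one, mul_one] at h3
      rw [hMeq, Matrix.add_mulVec, Matrix.smul_mulVec, dotProduct_add, dotProduct_smul, hz,
        smul_zero, zero_add, ← hpp] at h2
      rw [← hp] at h2
      rw [h2] at h3
      have h4 : q / 2 * (p ⬝ᵥ p) ≤ ε * √(p ⬝ᵥ p) :=
        (mul_le_mul_of_nonneg_right (by linarith) (hnn p)).trans h3
      have h5 : √(p ⬝ᵥ p) ≤ 2 * ε / q := by
        rw [le_div_iff₀ hq]
        by_contra hcon
        push Not at hcon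
        have hpos : 0 < √(p ⬝ᵥ p) := by
          by_contra h0
          have : √(p ⬝ᵥ p) = 0 := le_antisymm (not_lt.1 h0) (Real.sqrt_nonneg _)
          rw [this] at hcon; linarith
        have h6 := Real.mul_self_sqrt (hnn p)
        nlinarith
      calc p ⬝ᵥ p = √(p ⬝ᵥ p) ^ 2 := (Real.sq_sqrt (hnn p)).symm
        _ ≤ _ := pow_le_pow_left₀ (Real.sqrt_nonneg _) h5 2
  have hb : 0 ≤ 2 * ε / q := by positivity
  unfold sinTheta frobNorm
  rw [← Real.sqrt_sq hb, ← Real.sqrt_mul (Nat.cast_nonneg r)]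
  refine Real.sqrt_le_sqrt ?_
  rw [Finset.sum_comm]
  calc ∑ j, ∑ i, ((1 - Us * Usᵀ) * U : Matrix (Fin d) (Fin r) ℝ) i j ^ 2 =
         ∑ j, ((1 - P) *ᵥ Uᵀ j) ⬝ᵥ ((1 - P) *ᵥ Uᵀ j) := by
        refine Finset.sum_congr rfl fun j _ => Finset.sum_congr rfl fun i _ => ?_
        rw [sq]; rfl
    _ ≤ ∑ _j : Fin r, (2 * ε / q) ^ 2 := Finset.sum_le_sum fun j _ => hcol j
    _ = r * (2 * ε / q) ^ 2 := by simp

/-! ### Nets and the operator norm -/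

/-- A `1/2`-net of the unit ball of a Euclidean space with at most `5 ^ d` points. -/
lemma exists_half_net (d : ℕ) : ∃ N : Finset (EuclideanSpace ℝ (Fin d)),
    N.card ≤ 5 ^ d ∧ (∀ u ∈ N, ‖u‖ ≤ 1) ∧ ∀ x, ‖x‖ ≤ 1 → ∃ u ∈ N, ‖x - u‖ ≤ 1 / 2 := by
  classical
  let p : Finset (EuclideanSpace ℝ (Fin d)) → Prop := fun s =>
    (∀ c ∈ s, ‖c‖ ≤ 2) ∧ ∀ c ∈ s, ∀ e ∈ s, c ≠ e → 1 ≤ ‖c - e‖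
  have hcard : ∀ s, p s → s.card ≤ 5 ^ d := fun s hs => by
    simpa using Besicovitch.card_le_of_separated s hs.1 hs.2
  -- A `1`-separated set of maximal cardinality in the ball of radius `2`: by maximality it is a
  -- `1`-net there, and halving it gives the `1/2`-net of the unit ball.
  obtain ⟨s, hs, hsk⟩ := Nat.findGreatest_spec (P := fun k => ∃ s, p s ∧ s.card = k)
    (Nat.zero_le (5 ^ d)) ⟨∅, by simp [p], rfl⟩
  refine ⟨s.image fun c => (1 / 2 : ℝ) • c, Finset.card_image_le.trans (hcard s hs), ?_, ?_⟩
  · intro u hu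
    obtain ⟨c, hc, rfl⟩ := Finset.mem_image.1 hu
    rw [norm_smul]; norm_num
    linarith [hs.1 c hc]
  · intro x hx
    by_contra hcon
    push Not at hcon
    have hfar : ∀ c ∈ s, 1 ≤ ‖(2 : ℝ) • x - c‖ := by
      intro c hc
      have h1 := hcon _ (Finset.mem_image_of_mem _ hc)
      have h2 : (2 : ℝ) • x - c = (2 : ℝ) • (x - (1 / 2 : ℝ) • c) := by
        rw [smul_sub, smul_smul]; norm_num
      rw [h2, norm_smul]; norm_num
      norm_num at h1
      linarith
    have hnot : (2 : ℝ) • x ∉ s := fun hmem => by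
      have := hfar _ hmem
      simp at this
      linarith
    have hp : p (insert ((2 : ℝ) • x) s) := by
      refine ⟨fun c hc => ?_, fun c hc e he hne => ?_⟩
      · rcases Finset.mem_insert.1 hc with rfl | hc
        · rw [norm_smul]; norm_num; linarith
        · exact hs.1 c hc
      · rcases Finset.mem_insert.1 hc with rfl | hc <;>
        rcases Finset.mem_insert.1 he with rfl | he
        · exact absurd rfl hne
        · exact hfar e he
        · rw [norm_sub_rev]; exact hfar c hc
        · exact hs.2 c hc e he hne
    have h3 := Nat.le_findGreatest (P := fun k => ∃ s, p s ∧ s.card = k) (hcard _ hp) ⟨_, hp, rfl⟩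
    rw [Finset.card_insert_of_notMem hnot, hsk] at h3
    omega

/-- Each of the two arguments of the bilinear form costs a factor `2`, the approximation error being
absorbed as half of the norm itself. -/
lemma norm_le_of_half_net {E : Type*} [NormedAddCommGroup E] [InnerProductSpace ℝ E]
    {N : Finset E} (hN : ∀ x, ‖x‖ ≤ 1 → ∃ u ∈ N, ‖x - u‖ ≤ 1 / 2) (B : E →L[ℝ] E) {m : ℝ}
    (hm : ∀ u ∈ N, ∀ v ∈ N, inner ℝ u (B v) ≤ m) : ‖B‖ ≤ 4 * m := by
  have hN1 : ∀ v ∈ N, ‖B v‖ ≤ 2 * m := by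
    intro v hv
    by_cases h0 : B v = 0
    · obtain ⟨u, hu, -⟩ := hN 0 (by simp)
      have := hm u hu v hv
      simp [h0] at this
      simp [h0, this]
    · have hpos : 0 < ‖B v‖ := norm_pos_iff.2 h0
      obtain ⟨u, hu, hux⟩ := hN (‖B v‖⁻¹ • B v) (by
        rw [norm_smul, norm_inv, norm_norm, inv_mul_cancel₀ hpos.ne'])
      have h1 : inner ℝ (‖B v‖⁻¹ • B v) (B v) = ‖B v‖ := by
        rw [real_inner_smul_left, real_inner_self_eq_norm_sq]; field_simp
      have h2 : inner ℝ (‖B v‖⁻¹ • B v - u) (B v) ≤ 1 / 2 * ‖B v‖ :=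
        (real_inner_le_norm _ _).trans (mul_le_mul_of_nonneg_right hux (norm_nonneg _))
      rw [inner_sub_left, h1] at h2
      have := hm u hu v hv
      linarith
  have hm0 : 0 ≤ m := by
    obtain ⟨u, hu, -⟩ := hN 0 (by simp)
    have := hN1 u hu
    have := norm_nonneg (B u)
    linarith
  have : ‖B‖ ≤ 2 * m + ‖B‖ / 2 := by
    refine B.opNorm_le_of_unit_norm (by positivity) fun x hx => ?_
    obtain ⟨v, hv, hxv⟩ := hN x hx.le
    calc ‖B x‖ = ‖B v + B (x - v)‖ := by rw [← map_add]; congr 2; abel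
      _ ≤ ‖B v‖ + ‖B (x - v)‖ := norm_add_le _ _
      _ ≤ 2 * m + ‖B‖ * (1 / 2) := add_le_add (hN1 v hv)
        ((B.le_opNorm _).trans (mul_le_mul_of_nonneg_left hxv (norm_nonneg _)))
      _ = _ := by ring
  linarith

/-- A smooth bound for the operator norm by exponentials of bilinear forms over a net. -/
lemma norm_le_sum_exp_of_half_net {E : Type*} [NormedAddCommGroup E] [InnerProductSpace ℝ E]
    {N : Finset E} (hN : ∀ x, ‖x‖ ≤ 1 → ∃ u ∈ N, ‖x - u‖ ≤ 1 / 2) (B : E →L[ℝ] E) {θ a : ℝ}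
    (hθ : 0 < θ) (ha : 0 < a) :
    ‖B‖ ≤ 4 / θ * (Real.log a + (∑ u ∈ N, ∑ v ∈ N, Real.exp (θ * inner ℝ u (B v))) / a - 1) := by
  set S := ∑ u ∈ N, ∑ v ∈ N, Real.exp (θ * inner ℝ u (B v)) with hS
  have := norm_le_of_half_net hN B (m := 1 / θ * (Real.log a + S / a - 1)) fun u hu v hv => by
    have h1 : Real.exp (θ * inner ℝ u (B v)) ≤ S :=
      (Finset.single_le_sum (f := fun v => Real.exp (θ * inner ℝ u (B v)))
        (fun _ _ => (Real.exp_pos _).le) hv).trans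
      (Finset.single_le_sum (f := fun u => ∑ v ∈ N, Real.exp (θ * inner ℝ u (B v)))
        (fun _ _ => Finset.sum_nonneg fun _ _ => (Real.exp_pos _).le) hu)
    have hSpos : 0 < S := (Real.exp_pos _).trans_le h1
    have h2 : θ * inner ℝ u (B v) ≤ Real.log S := (Real.le_log_iff_exp_le hSpos).2 h1
    -- The tangent line of the logarithm at `a` makes the bound affine in `S`, so its expectation
    -- needs only that of `S`.
    have h3 : Real.log (S / a) ≤ S / a - 1 := Real.log_le_sub_one_of_pos (by positivity)
    rw [Real.log_div hSpos.ne' ha.ne'] at h3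
    rw [one_div, inv_mul_eq_div, le_div_iff₀ hθ]
    linarith
  calc ‖B‖ ≤ _ := this
    _ = _ := by ring

/-! ### Square-exponential moments and products of sub-Gaussian variables -/

section SquareExponential

lemma lintegral_exp_mul_gaussianReal (y : ℝ) :
    ∫⁻ g, ENNReal.ofReal (Real.exp (y * g)) ∂(gaussianReal 0 1) =
      ENNReal.ofReal (Real.exp (y ^ 2 / 2)) := by
  rw [← ofReal_integral_eq_lintegral_ofReal (integrable_exp_mul_gaussianReal y)
    (ae_of_all _ fun _ => (Real.exp_pos _).le)]
  have := congrFun (mgf_id_gaussianReal (μ := 0) (v := 1)) y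
  simp only [mgf, id] at this
  rw [this]
  simp

/-- The coefficient `3/8` is chosen so that `(1 - 2 * (3/8)) ^ (-1/2) = 2`. -/
lemma lintegral_exp_sq_gaussianReal :
    ∫⁻ g, ENNReal.ofReal (Real.exp (3 / 8 * g ^ 2)) ∂(gaussianReal 0 1) = 2 := by
  have hpt : ∀ g : ℝ, gaussianPDF 0 1 g * ENNReal.ofReal (Real.exp (3 / 8 * g ^ 2)) =
      ENNReal.ofReal ((√(2 * Real.pi))⁻¹ * Real.exp (-(1 / 8) * g ^ 2)) := by
    intro g
    rw [gaussianPDF, ← ENNReal.ofReal_mul (gaussianPDFReal_nonneg _ _ _), gaussianPDFReal]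
    congr 1
    rw [mul_assoc, ← Real.exp_add]
    simp only [NNReal.coe_one, mul_one, sub_zero]
    congr 2
    ring
  rw [gaussianReal_of_var_ne_zero _ one_ne_zero,
    lintegral_withDensity_eq_lintegral_mul _ (measurable_gaussianPDF _ _) (by fun_prop)]
  simp only [Pi.mul_apply, hpt]
  rw [← ofReal_integral_eq_lintegral_ofReal
    ((integrable_exp_neg_mul_sq (by norm_num)).const_mul _)
    (ae_of_all _ fun _ => by positivity), integral_const_mul, integral_gaussian]
  have h1 : (√(2 * Real.pi))⁻¹ * √(Real.pi / (1 / 8)) = 2 := by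
    have : Real.pi / (1 / 8) = 2 ^ 2 * (2 * Real.pi) := by ring
    rw [this, Real.sqrt_mul (x := 2 ^ 2) (by norm_num), Real.sqrt_sq (by norm_num : (0 : ℝ) ≤ 2)]
    have : √(2 * Real.pi) ≠ 0 := by positivity
    field_simp
  rw [h1]; simp

/-- `X` has a square-exponential moment at scale `s`, bounded by `2`. -/
structure HasSqExpBound {Ω : Type*} [MeasurableSpace Ω] (X : Ω → ℝ) (s : ℝ) (μ : Measure Ω) :
    Prop where
  aemeasurable : AEMeasurable X μ
  integrable : Integrable (fun ω => Real.exp (s * X ω ^ 2)) μ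
  integral_le : ∫ ω, Real.exp (s * X ω ^ 2) ∂μ ≤ 2

variable {Ω : Type*} [MeasurableSpace Ω] {μ : Measure Ω}

lemma HasSqExpBound.integrable_sq {X : Ω → ℝ} {s : ℝ}
    (h : HasSqExpBound X s μ) (hs : 0 < s) : Integrable (fun ω => X ω ^ 2) μ := by
  refine (h.integrable.const_mul s⁻¹).mono' (h.aemeasurable.pow_const 2).aestronglyMeasurable
    (ae_of_all _ fun ω => ?_)
  rw [Real.norm_of_nonneg (sq_nonneg _), inv_mul_eq_div, le_div_iff₀ hs]
  linarith [Real.add_one_le_exp (s * X ω ^ 2)]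

lemma HasSqExpBound.memLp_two {X : Ω → ℝ} {s : ℝ}
    (h : HasSqExpBound X s μ) (hs : 0 < s) : MemLp X 2 μ :=
  (memLp_two_iff_integrable_sq h.aemeasurable.aestronglyMeasurable).2 (h.integrable_sq hs)

lemma HasSqExpBound.integrable_mul {X Y : Ω → ℝ} {s : ℝ}
    (hX : HasSqExpBound X s μ) (hY : HasSqExpBound Y s μ) (hs : 0 < s) :
    Integrable (fun ω => X ω * Y ω) μ :=
  (hX.memLp_two hs).integrable_mul (hY.memLp_two hs)

variable [IsProbabilityMeasure μ]

/-- Gaussian linearization: `exp (s X²)` is the mean of `exp (√(2s) X g)` over a standard Gaussian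
`g`. After Tonelli the sub-Gaussian bound applies for fixed `g` and leaves a Gaussian integral. -/
lemma hasSqExpBound_of_hasSubgaussianMGF {X : Ω → ℝ} {c : NNReal} (hX : HasSubgaussianMGF X c μ)
    {s : ℝ} (hs : 0 ≤ s) (hcs : s * c ≤ 3 / 8) : HasSqExpBound X s μ := by
  have hm := hX.aemeasurable
  have key : ∫⁻ ω, ENNReal.ofReal (Real.exp (s * X ω ^ 2)) ∂μ ≤ 2 := by
    calc ∫⁻ ω, ENNReal.ofReal (Real.exp (s * X ω ^ 2)) ∂μ
        = ∫⁻ ω, ∫⁻ g, ENNReal.ofReal (Real.exp (√(2 * s) * X ω * g)) ∂(gaussianReal 0 1) ∂μ := by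
          refine lintegral_congr fun ω => ?_
          rw [lintegral_exp_mul_gaussianReal, mul_pow, Real.sq_sqrt (by positivity)]
          congr 2; ring
      _ = ∫⁻ g, ∫⁻ ω, ENNReal.ofReal (Real.exp (√(2 * s) * X ω * g)) ∂μ ∂(gaussianReal 0 1) := by
          refine lintegral_lintegral_swap ?_
          have h1 : AEMeasurable (fun p : Ω × ℝ => X p.1) (μ.prod (gaussianReal 0 1)) :=
            hm.comp_fst
          exact (Real.measurable_exp.comp_aemeasurable
            ((h1.const_mul _).mul measurable_snd.aemeasurable)).ennreal_ofReal
      _ ≤ ∫⁻ g, ENNReal.ofReal (Real.exp (3 / 8 * g ^ 2)) ∂(gaussianReal 0 1) := by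
          refine lintegral_mono fun g => ?_
          have h1 : ∀ ω, √(2 * s) * X ω * g = (√(2 * s) * g) * X ω := fun ω => by ring
          simp only [h1]
          rw [← ofReal_integral_eq_lintegral_ofReal (hX.integrable_exp_mul _)
            (ae_of_all _ fun _ => (Real.exp_pos _).le)]
          refine ENNReal.ofReal_le_ofReal ((hX.mgf_le _).trans (Real.exp_le_exp.2 ?_))
          rw [mul_pow, Real.sq_sqrt (by positivity)]
          nlinarith [sq_nonneg g]
      _ = 2 := lintegral_exp_sq_gaussianReal
  have hmeas : AEStronglyMeasurable (fun ω => Real.exp (s * X ω ^ 2)) μ :=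
    (Real.measurable_exp.comp_aemeasurable ((hm.pow_const 2).const_mul s)).aestronglyMeasurable
  refine ⟨hm, ⟨hmeas, ?_⟩, ?_⟩
  · rw [hasFiniteIntegral_iff_ofReal (ae_of_all _ fun _ => (Real.exp_pos _).le)]
    exact key.trans_lt (by simp)
  · rw [integral_eq_lintegral_of_nonneg_ae (ae_of_all _ fun _ => (Real.exp_pos _).le) hmeas]
    exact ENNReal.toReal_le_of_le_ofReal (by norm_num) (by simpa using key)

namespace HasSqExpBound

variable {X Y : Ω → ℝ} {s : ℝ}

lemma integral_sq_le (h : HasSqExpBound X s μ) (hs : 0 < s) : ∫ ω, X ω ^ 2 ∂μ ≤ 1 / s := by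
  have h1 : ∫ ω, s * X ω ^ 2 ∂μ ≤ ∫ ω, (Real.exp (s * X ω ^ 2) - 1) ∂μ :=
    integral_mono ((h.integrable_sq hs).const_mul s) (h.integrable.sub (integrable_const 1))
      fun ω => by linarith [Real.add_one_le_exp (s * X ω ^ 2)]
  rw [integral_const_mul, integral_sub h.integrable (integrable_const 1), integral_const,
    probReal_univ, one_smul] at h1
  rw [le_div_iff₀ hs]
  linarith [h.integral_le]

end HasSqExpBound

lemma exp_le_one_add_add_sq_mul_exp_abs (y : ℝ) :
    Real.exp y ≤ 1 + y + y ^ 2 * Real.exp |y| := by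
  have h := Complex.norm_exp_sub_sum_le_norm_mul_exp (y : ℂ) 2
  rw [Finset.sum_range_succ, Finset.sum_range_one] at h
  have e : Complex.exp y - ((y : ℂ) ^ 0 / (Nat.factorial 0 : ℕ) + (y : ℂ) ^ 1 / (Nat.factorial 1 : ℕ)) =
      ((Real.exp y - (1 + y) : ℝ) : ℂ) := by
    push_cast; simp
  rw [e, Complex.norm_real, Complex.norm_real, Real.norm_eq_abs, Real.norm_eq_abs, sq_abs] at h
  linarith [le_abs_self (Real.exp y - (1 + y))]

/-- The moment generating function bound for centred sub-exponential random variables. -/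
lemma mgf_le_of_integral_exp_abs_le {Y : Ω → ℝ} {s B θ : ℝ} (hs : 0 < s)
    (hint : Integrable Y μ) (hexp : Integrable (fun ω => Real.exp (2 * s * |Y ω|)) μ)
    (hB : ∫ ω, Real.exp (2 * s * |Y ω|) ∂μ ≤ B) (hY : ∫ ω, Y ω ∂μ = 0) (hθ : |θ| ≤ s) :
    Integrable (fun ω => Real.exp (θ * Y ω)) μ ∧
      mgf Y μ θ ≤ Real.exp (2 * B * θ ^ 2 / s ^ 2) := by
  have hpt : ∀ ω, Real.exp (θ * Y ω) ≤
      1 + θ * Y ω + 2 * θ ^ 2 / s ^ 2 * Real.exp (2 * s * |Y ω|) := by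
    intro ω
    have h1 := exp_le_one_add_add_sq_mul_exp_abs (θ * Y ω)
    have h2 : Real.exp |θ * Y ω| ≤ Real.exp (s * |Y ω|) := by
      rw [abs_mul]
      exact Real.exp_le_exp.2 (mul_le_mul_of_nonneg_right hθ (abs_nonneg _))
    -- The quadratic factor is absorbed by a second copy of `exp (s |Y|)`; hence the moment at `2 *
    -- s` in the hypothesis.
    have h3 : (s * |Y ω|) ^ 2 ≤ 2 * Real.exp (s * |Y ω|) := by
      have hnn : 0 ≤ s * |Y ω| := by positivity
      have := Real.quadratic_le_exp_of_nonneg hnn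
      linarith
    have h4 : (θ * Y ω) ^ 2 = θ ^ 2 / s ^ 2 * (s * |Y ω|) ^ 2 := by
      rw [mul_pow, mul_pow, sq_abs]; field_simp
    have h5 : Real.exp (2 * s * |Y ω|) = Real.exp (s * |Y ω|) * Real.exp (s * |Y ω|) := by
      rw [← Real.exp_add]; congr 1; ring
    have h6 : (θ * Y ω) ^ 2 * Real.exp |θ * Y ω| ≤
        θ ^ 2 / s ^ 2 * (2 * Real.exp (s * |Y ω|)) * Real.exp (s * |Y ω|) := by
      rw [h4]
      gcongr
    rw [h5]
    calc _ ≤ _ := h1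
      _ ≤ 1 + θ * Y ω + θ ^ 2 / s ^ 2 * (2 * Real.exp (s * |Y ω|)) * Real.exp (s * |Y ω|) := by
        linarith
      _ = _ := by ring
  have hI : Integrable (fun ω => 1 + θ * Y ω + 2 * θ ^ 2 / s ^ 2 * Real.exp (2 * s * |Y ω|)) μ :=
    ((integrable_const 1).add (hint.const_mul θ)).add (hexp.const_mul _)
  have hE : Integrable (fun ω => Real.exp (θ * Y ω)) μ := by
    refine hI.mono' (Real.measurable_exp.comp_aemeasurable
      (hint.aemeasurable.const_mul θ)).aestronglyMeasurable (ae_of_all _ fun ω => ?_)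
    rw [Real.norm_of_nonneg (Real.exp_pos _).le]
    exact hpt ω
  refine ⟨hE, ?_⟩
  calc mgf Y μ θ ≤ ∫ ω, (1 + θ * Y ω + 2 * θ ^ 2 / s ^ 2 * Real.exp (2 * s * |Y ω|)) ∂μ :=
        integral_mono hE hI hpt
    _ = 1 + 2 * θ ^ 2 / s ^ 2 * ∫ ω, Real.exp (2 * s * |Y ω|) ∂μ := by
        rw [integral_add (f := fun ω => 1 + θ * Y ω) ((integrable_const 1).add (hint.const_mul θ))
          (hexp.const_mul _), integral_add (integrable_const 1) (hint.const_mul θ),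
          integral_const_mul, integral_const_mul, hY]
        simp
    _ ≤ 1 + 2 * θ ^ 2 / s ^ 2 * B := by gcongr
    _ ≤ Real.exp (2 * B * θ ^ 2 / s ^ 2) := by
        have := Real.add_one_le_exp (2 * B * θ ^ 2 / s ^ 2)
        calc _ = 2 * B * θ ^ 2 / s ^ 2 + 1 := by ring
          _ ≤ _ := this

/-- Since `|XY| ≤ (X² + Y²) / 2`, the product is sub-exponential at scale `s`, and centring costs a
factor at most `e`. With `B = 5.5 ≥ 2e` and scale `s / 2`, the constant is `2 * 5.5 * 4 = 44`. -/
lemma HasSqExpBound.mgf_mul_sub_integral_le {X Y : Ω → ℝ} {s θ : ℝ} (hs : 0 < s)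
    (hX : HasSqExpBound X s μ) (hY : HasSqExpBound Y s μ) (hθ : |θ| ≤ s / 2) :
    Integrable (fun ω => Real.exp (θ * (X ω * Y ω - ∫ ω', X ω' * Y ω' ∂μ))) μ ∧
      mgf (fun ω => X ω * Y ω - ∫ ω', X ω' * Y ω' ∂μ) μ θ ≤ Real.exp (44 * θ ^ 2 / s ^ 2) := by
  set m := ∫ ω', X ω' * Y ω' ∂μ with hm
  have hint := hX.integrable_mul hY hs
  have hab : ∀ ω, |X ω * Y ω| ≤ (X ω ^ 2 + Y ω ^ 2) / 2 := fun ω => by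
    rw [abs_le]
    constructor <;> nlinarith [sq_nonneg (X ω + Y ω), sq_nonneg (X ω - Y ω)]
  have hmle : |m| ≤ 1 / s := by
    calc |m| ≤ ∫ ω, |X ω * Y ω| ∂μ := abs_integral_le_integral_abs
      _ ≤ ∫ ω, (X ω ^ 2 + Y ω ^ 2) / 2 ∂μ :=
        integral_mono hint.abs (((hX.integrable_sq hs).add (hY.integrable_sq hs)).div_const 2) hab
      _ = (∫ ω, X ω ^ 2 ∂μ + ∫ ω, Y ω ^ 2 ∂μ) / 2 := by
        rw [integral_div, integral_add (hX.integrable_sq hs) (hY.integrable_sq hs)]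
      _ ≤ 1 / s := by linarith [hX.integral_sq_le hs, hY.integral_sq_le hs]
  have hpt : ∀ ω, Real.exp (2 * (s / 2) * |X ω * Y ω - m|) ≤
      Real.exp 1 * ((Real.exp (s * X ω ^ 2) + Real.exp (s * Y ω ^ 2)) / 2) := by
    intro ω
    have h1 : 2 * (s / 2) * |X ω * Y ω - m| ≤ 1 + (s * X ω ^ 2 + s * Y ω ^ 2) / 2 := by
      have h2 : |X ω * Y ω - m| ≤ (X ω ^ 2 + Y ω ^ 2) / 2 + 1 / s :=
        (abs_sub _ _).trans (add_le_add (hab ω) hmle)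
      calc 2 * (s / 2) * |X ω * Y ω - m| = s * |X ω * Y ω - m| := by ring
        _ ≤ s * ((X ω ^ 2 + Y ω ^ 2) / 2 + 1 / s) := by gcongr
        _ = _ := by field_simp; ring
    have h3 : Real.exp ((s * X ω ^ 2 + s * Y ω ^ 2) / 2) ≤
        (Real.exp (s * X ω ^ 2) + Real.exp (s * Y ω ^ 2)) / 2 := by
      have e : Real.exp ((s * X ω ^ 2 + s * Y ω ^ 2) / 2) =
          Real.exp (s * X ω ^ 2 / 2) * Real.exp (s * Y ω ^ 2 / 2) := by
        rw [← Real.exp_add]; congr 1; ring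
      have e2 : ∀ t : ℝ, Real.exp t = Real.exp (t / 2) ^ 2 := fun t => by
        rw [← Real.exp_nat_mul]; congr 1; push_cast; ring
      rw [e, e2 (s * X ω ^ 2), e2 (s * Y ω ^ 2)]
      nlinarith [sq_nonneg (Real.exp (s * X ω ^ 2 / 2) - Real.exp (s * Y ω ^ 2 / 2))]
    calc _ ≤ Real.exp (1 + (s * X ω ^ 2 + s * Y ω ^ 2) / 2) := Real.exp_le_exp.2 h1
      _ = Real.exp 1 * Real.exp ((s * X ω ^ 2 + s * Y ω ^ 2) / 2) := Real.exp_add _ _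
      _ ≤ _ := by gcongr
  have hI : Integrable (fun ω => Real.exp 1 *
      ((Real.exp (s * X ω ^ 2) + Real.exp (s * Y ω ^ 2)) / 2)) μ :=
    ((hX.integrable.add hY.integrable).div_const 2).const_mul _
  have hintY : Integrable (fun ω => X ω * Y ω - m) μ := hint.sub (integrable_const m)
  have hexp : Integrable (fun ω => Real.exp (2 * (s / 2) * |X ω * Y ω - m|)) μ := by
    refine hI.mono' (Real.measurable_exp.comp_aemeasurable
      (hintY.abs.aemeasurable.const_mul _)).aestronglyMeasurable (ae_of_all _ fun ω => ?_)
    rw [Real.norm_of_nonneg (Real.exp_pos _).le]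
    exact hpt ω
  have hB : ∫ ω, Real.exp (2 * (s / 2) * |X ω * Y ω - m|) ∂μ ≤ 5.5 := by
    calc _ ≤ ∫ ω, Real.exp 1 * ((Real.exp (s * X ω ^ 2) + Real.exp (s * Y ω ^ 2)) / 2) ∂μ :=
          integral_mono hexp hI hpt
      _ = Real.exp 1 * ((∫ ω, Real.exp (s * X ω ^ 2) ∂μ + ∫ ω, Real.exp (s * Y ω ^ 2) ∂μ) / 2) := by
          rw [integral_const_mul, integral_div, integral_add hX.integrable hY.integrable]
      _ ≤ 2.75 * ((2 + 2) / 2) := by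
          refine mul_le_mul (by linarith [Real.exp_one_lt_d9]) ?_ ?_ (by norm_num)
          · linarith [hX.integral_le, hY.integral_le]
          · exact div_nonneg (add_nonneg (integral_nonneg fun ω => (Real.exp_pos _).le)
              (integral_nonneg fun ω => (Real.exp_pos _).le)) (by norm_num)
      _ = 5.5 := by norm_num
  have hz : ∫ ω, (X ω * Y ω - m) ∂μ = 0 := by
    rw [integral_sub hint (integrable_const m), integral_const, probReal_univ, one_smul, hm,
      sub_self]
  have h := mgf_le_of_integral_exp_abs_le (half_pos hs) hintY hexp hB hz hθ
  refine ⟨h.1, h.2.trans (le_of_eq ?_)⟩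
  congr 1
  field_simp
  ring

end SquareExponential

/-! ### Concentration of the empirical second moment matrix -/

section SecondMoment

variable {Ω : Type*} [MeasurableSpace Ω] {μ : Measure Ω} [IsProbabilityMeasure μ]

/-- The empirical second moment matrix. -/
def secondMoment {n d : ℕ} (x : Fin n → Fin d → ℝ) : Matrix (Fin d) (Fin d) ℝ :=
  Matrix.of fun k l => (1 / (n : ℝ)) * ∑ i, x i k * x i l

lemma dotProduct_secondMoment_mulVec {n d : ℕ} (x : Fin n → Fin d → ℝ) (u v : Fin d → ℝ) :
    u ⬝ᵥ (secondMoment x *ᵥ v) = (1 / (n : ℝ)) * ∑ i, (u ⬝ᵥ x i) * (v ⬝ᵥ x i) := by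
  simp only [dotProduct, mulVec, secondMoment, Matrix.of_apply, Finset.sum_mul, Finset.mul_sum]
  rw [Finset.sum_congr rfl fun k _ => Finset.sum_comm, Finset.sum_comm]
  refine Finset.sum_congr rfl fun i _ => ?_
  rw [Finset.sum_comm]
  exact Finset.sum_congr rfl fun k _ => Finset.sum_congr rfl fun l _ => by ring

/-- Moment generating function bound for bilinear forms of the empirical second moment matrix. -/
lemma integral_exp_bilin_secondMoment_le {n d : ℕ} (hn : 0 < n) {x : Fin n → Ω → Fin d → ℝ}
    (hmeas : ∀ i, Measurable (x i)) (hindep : iIndepFun x μ) {C : Matrix (Fin d) (Fin d) ℝ}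
    (hC : ∀ i u v, ∫ ω, (u ⬝ᵥ x i ω) * (v ⬝ᵥ x i ω) ∂μ = u ⬝ᵥ (C *ᵥ v)) {s θ : ℝ} (hs : 0 < s)
    (hθ : |θ| ≤ n * (s / 2)) {u v : Fin d → ℝ}
    (hu : ∀ i, HasSqExpBound (fun ω => u ⬝ᵥ x i ω) s μ)
    (hv : ∀ i, HasSqExpBound (fun ω => v ⬝ᵥ x i ω) s μ) :
    Integrable (fun ω => Real.exp
      (θ * (u ⬝ᵥ ((secondMoment (fun i => x i ω) - C) *ᵥ v)))) μ ∧
    ∫ ω, Real.exp (θ * (u ⬝ᵥ ((secondMoment (fun i => x i ω) - C) *ᵥ v))) ∂μ ≤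
      Real.exp (44 * θ ^ 2 / (n * s ^ 2)) := by
  have hn' : (0 : ℝ) < n := by exact_mod_cast hn
  set Y : Fin n → Ω → ℝ := fun i ω => (u ⬝ᵥ x i ω) * (v ⬝ᵥ x i ω) - u ⬝ᵥ (C *ᵥ v) with hY
  have hrw : ∀ ω, θ * (u ⬝ᵥ ((secondMoment (fun i => x i ω) - C) *ᵥ v)) =
      θ / n * (∑ i, Y i) ω := by
    intro ω
    rw [Matrix.sub_mulVec, dotProduct_sub, dotProduct_secondMoment_mulVec, Finset.sum_apply]
    simp only [hY, Finset.sum_sub_distrib, Finset.sum_const, Finset.card_univ, Fintype.card_fin,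
      nsmul_eq_mul]
    field_simp
  have hg : Measurable fun y : Fin d → ℝ => (u ⬝ᵥ y) * (v ⬝ᵥ y) - u ⬝ᵥ (C *ᵥ v) := by
    unfold dotProduct; fun_prop
  have hYm : ∀ i, Measurable (Y i) := fun i => hg.comp (hmeas i)
  have hYi : iIndepFun Y μ := hindep.comp (fun _ y => (u ⬝ᵥ y) * (v ⬝ᵥ y) - u ⬝ᵥ (C *ᵥ v))
    fun _ => hg
  have hθn : |θ / n| ≤ s / 2 := by
    rw [abs_div, abs_of_pos hn', div_le_iff₀ hn']; linarith
  have hone : ∀ i, Integrable (fun ω => Real.exp (θ / n * Y i ω)) μ ∧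
      mgf (Y i) μ (θ / n) ≤ Real.exp (44 * (θ / n) ^ 2 / s ^ 2) := by
    intro i
    have := (hu i).mgf_mul_sub_integral_le hs (hv i) hθn
    rwa [hC i u v] at this
  simp only [hrw]
  refine ⟨hYi.integrable_exp_mul_sum hYm fun i _ => (hone i).1, ?_⟩
  calc ∫ ω, Real.exp (θ / n * (∑ i, Y i) ω) ∂μ = mgf (∑ i, Y i) μ (θ / n) := rfl
    _ = ∏ i, mgf (Y i) μ (θ / n) := hYi.mgf_sum hYm Finset.univ
    _ ≤ ∏ _i : Fin n, Real.exp (44 * (θ / n) ^ 2 / s ^ 2) :=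
      Finset.prod_le_prod (fun i _ => mgf_nonneg) fun i _ => (hone i).2
    _ = Real.exp (44 * θ ^ 2 / (n * s ^ 2)) := by
      rw [Finset.prod_const, Finset.card_univ, Fintype.card_fin, ← Real.exp_nat_mul]
      congr 1
      field_simp

/-- The expected operator norm error of the empirical second moment matrix is `O(√(d / n))`. -/
lemma exists_integrable_bound_norm_secondMoment_sub {n d : ℕ} (hd : 0 < d) (hdn : d ≤ n)
    {x : Fin n → Ω → Fin d → ℝ} (hmeas : ∀ i, Measurable (x i)) (hindep : iIndepFun x μ)
    {C : Matrix (Fin d) (Fin d) ℝ}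
    (hC : ∀ i u v, ∫ ω, (u ⬝ᵥ x i ω) * (v ⬝ᵥ x i ω) ∂μ = u ⬝ᵥ (C *ᵥ v)) {s : ℝ} (hs : 0 < s)
    (hx : ∀ i u, u ⬝ᵥ u ≤ 1 → HasSqExpBound (fun ω => u ⬝ᵥ x i ω) s μ) :
    ∃ F : Ω → ℝ, Integrable F μ ∧ ∫ ω, F ω ∂μ ≤ 280 / s * √(d / n) ∧
      ∀ ω, ‖toEuclideanCLM (𝕜 := ℝ) (secondMoment (fun i => x i ω) - C)‖ ≤ F ω := by
  obtain ⟨N, hNcard, hNball, hNnet⟩ := exists_half_net d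
  have hn : 0 < n := hd.trans_le hdn
  have hn' : (0 : ℝ) < n := by exact_mod_cast hn
  have hd' : (0 : ℝ) < d := by exact_mod_cast hd
  have hdn' : (d : ℝ) ≤ n := by exact_mod_cast hdn
  -- This choice makes the exponent `44 θ² / (n s²)` equal to `11 d`, of the same order as the
  -- logarithm of the net size; `d ≤ n` keeps `θ` in the admissible range.
  set θ : ℝ := s / 2 * √(n * d) with hθdef
  have hθ : 0 < θ := by positivity
  have hθle : |θ| ≤ n * (s / 2) := by
    rw [abs_of_pos hθ, hθdef, mul_comm (n : ℝ) (s / 2)]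
    gcongr
    calc √(n * d) ≤ √(n * n) := Real.sqrt_le_sqrt (by gcongr)
      _ = n := Real.sqrt_mul_self hn'.le
  have hb : 44 * θ ^ 2 / (n * s ^ 2) = 11 * d := by
    rw [hθdef, mul_pow, Real.sq_sqrt (by positivity)]; field_simp; norm_num
  have hone : ∀ u ∈ N, ∀ v ∈ N, _ := fun u hu v hv =>
    integral_exp_bilin_secondMoment_le hn hmeas hindep hC hs hθle
      (u := u.ofLp) (v := v.ofLp)
      (fun i => hx i _ (by
        have := hNball u hu
        have h2 : u.ofLp ⬝ᵥ u.ofLp = ‖u‖ ^ 2 := by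
          rw [EuclideanSpace.real_norm_sq_eq]; simp [dotProduct, sq]
        rw [h2]; exact pow_le_one₀ (norm_nonneg _) this))
      (fun i => hx i _ (by
        have := hNball v hv
        have h2 : v.ofLp ⬝ᵥ v.ofLp = ‖v‖ ^ 2 := by
          rw [EuclideanSpace.real_norm_sq_eq]; simp [dotProduct, sq]
        rw [h2]; exact pow_le_one₀ (norm_nonneg _) this))
  -- At most `25 ^ d` pairs of net points, each contributing at most `exp (11 d)`, so `a` dominates
  -- the mean of `S`.
  set a : ℝ := 25 ^ d * Real.exp (11 * d) with ha
  have hapos : 0 < a := by positivity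
  set S : Ω → ℝ := fun ω => ∑ u ∈ N, ∑ v ∈ N, Real.exp
    (θ * (u.ofLp ⬝ᵥ ((secondMoment (fun i => x i ω) - C) *ᵥ v.ofLp))) with hS
  have hSint : Integrable S μ :=
    integrable_finsetSum _ fun u hu => integrable_finsetSum _ fun v hv => (hone u hu v hv).1
  have hSle : ∫ ω, S ω ∂μ ≤ a := by
    rw [hS, integral_finsetSum _ fun u hu => integrable_finsetSum _ fun v hv => (hone u hu v hv).1]
    calc _ ≤ ∑ u ∈ N, ∑ v ∈ N, Real.exp (11 * d) := by
          refine Finset.sum_le_sum fun u hu => ?_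
          rw [integral_finsetSum _ fun v hv => (hone u hu v hv).1]
          exact Finset.sum_le_sum fun v hv => (hone u hu v hv).2.trans_eq (by rw [hb])
      _ = (N.card : ℝ) * N.card * Real.exp (11 * d) := by
          simp only [Finset.sum_const, nsmul_eq_mul]; ring
      _ ≤ (5 ^ d) * (5 ^ d) * Real.exp (11 * d) := by
          have : (N.card : ℝ) ≤ 5 ^ d := by exact_mod_cast hNcard
          gcongr
      _ = a := by rw [ha, ← mul_pow]; norm_num
  refine ⟨fun ω => 4 / θ * (Real.log a + S ω / a - 1),
    (((integrable_const _).add (hSint.div_const a)).sub (integrable_const 1)).const_mul _, ?_, ?_⟩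
  · rw [integral_const_mul, integral_sub (f := fun ω => Real.log a + S ω / a) ((integrable_const _).add (hSint.div_const a))
      (integrable_const 1), integral_add (integrable_const _) (hSint.div_const a), integral_div]
    simp only [integral_const, probReal_univ, one_smul]
    have h1 : (∫ ω, S ω ∂μ) / a ≤ 1 := (div_le_one hapos).2 hSle
    -- The crude bound `log 25 ≤ 24` gives `24 + 11 = 35`.
    have h2 : Real.log a ≤ 35 * d := by
      rw [ha, Real.log_mul (by positivity) (by positivity), Real.log_exp, Real.log_pow]
      have := Real.log_le_sub_one_of_pos (show (0 : ℝ) < 25 by norm_num)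
      nlinarith
    calc 4 / θ * (Real.log a + (∫ ω, S ω ∂μ) / a - 1) ≤ 4 / θ * (35 * d) := by
          gcongr; linarith
      _ = 280 / s * √(d / n) := by
          have h3 : (d : ℝ) = √d * √d := (Real.mul_self_sqrt hd'.le).symm
          have hsd : √(d : ℝ) ≠ 0 := by positivity
          have hsn : √(n : ℝ) ≠ 0 := by positivity
          rw [hθdef, Real.sqrt_mul hn'.le, Real.sqrt_div hd'.le]
          nth_rewrite 2 [h3]
          field_simp
          norm_num
  · intro ω
    have := norm_le_sum_exp_of_half_net hNnet
      (toEuclideanCLM (𝕜 := ℝ) (secondMoment (fun i => x i ω) - C)) hθ hapos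
    simpa only [inner_toEuclideanCLM] using this

end SecondMoment

/-! ### Bilinear bounds and the decomposition of the contrast matrix -/

/-- `M` is bounded by `ε` as a bilinear form for the Euclidean norm. -/
def BilinBound {d : ℕ} (M : Matrix (Fin d) (Fin d) ℝ) (ε : ℝ) : Prop :=
  ∀ u v, |u ⬝ᵥ (M *ᵥ v)| ≤ ε * (√(u ⬝ᵥ u) * √(v ⬝ᵥ v))

lemma dotProduct_self_real_nonneg {d : ℕ} (v : Fin d → ℝ) : 0 ≤ v ⬝ᵥ v :=
  Finset.sum_nonneg fun _ _ => mul_self_nonneg _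

lemma sum_abs_mul_le {d : ℕ} (u v : Fin d → ℝ) :
    ∑ k, |u k| * |v k| ≤ √(u ⬝ᵥ u) * √(v ⬝ᵥ v) := by
  refine (Real.sum_mul_le_sqrt_mul_sqrt Finset.univ (fun k => |u k|) fun k => |v k|).trans
    (le_of_eq ?_)
  simp only [dotProduct, sq, abs_mul_abs_self]

lemma abs_dotProduct_le {d : ℕ} (u v : Fin d → ℝ) : |u ⬝ᵥ v| ≤ √(u ⬝ᵥ u) * √(v ⬝ᵥ v) := by
  refine (Finset.abs_sum_le_sum_abs _ _).trans ((Finset.sum_le_sum fun k _ => ?_).trans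
    (sum_abs_mul_le u v))
  rw [abs_mul]

namespace BilinBound

variable {d : ℕ} {M N : Matrix (Fin d) (Fin d) ℝ} {ε δ : ℝ}

lemma add (hM : BilinBound M ε) (hN : BilinBound N δ) : BilinBound (M + N) (ε + δ) := by
  intro u v
  rw [Matrix.add_mulVec, dotProduct_add, add_mul]
  exact (abs_add_le _ _).trans (add_le_add (hM u v) (hN u v))

lemma smul (hM : BilinBound M ε) (c : ℝ) : BilinBound (c • M) (|c| * ε) := by
  intro u v
  rw [Matrix.smul_mulVec, dotProduct_smul, smul_eq_mul, abs_mul, mul_assoc]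
  exact mul_le_mul_of_nonneg_left (hM u v) (abs_nonneg c)

lemma sub (hM : BilinBound M ε) (hN : BilinBound N δ) : BilinBound (M - N) (ε + δ) := by
  intro u v
  rw [Matrix.sub_mulVec, dotProduct_sub, add_mul]
  exact (abs_sub _ _).trans (add_le_add (hM u v) (hN u v))

lemma mono (hM : BilinBound M ε) (h : ε ≤ δ) : BilinBound M δ := fun u v =>
  (hM u v).trans (mul_le_mul_of_nonneg_right h (by positivity))

lemma abs_apply_le (hM : BilinBound M ε) (k : Fin d) : |M k k| ≤ ε := by
  simpa using hM (Pi.single k 1) (Pi.single k 1)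

end BilinBound

lemma bilinBound_norm {d : ℕ} (M : Matrix (Fin d) (Fin d) ℝ) :
    BilinBound M ‖toEuclideanCLM (𝕜 := ℝ) M‖ := by
  intro u v
  have hn : ∀ w : Fin d → ℝ, √(w ⬝ᵥ w) = ‖WithLp.toLp 2 w‖ := fun w => by
    rw [EuclideanSpace.norm_eq]; simp [dotProduct, sq]
  have h := inner_toEuclideanCLM M (WithLp.toLp 2 u) (WithLp.toLp 2 v)
  rw [hn, hn, ← h]
  refine (abs_real_inner_le_norm _ _).trans ?_
  calc _ ≤ ‖WithLp.toLp 2 u‖ * (‖toEuclideanCLM (𝕜 := ℝ) M‖ * ‖WithLp.toLp 2 v‖) := by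
        gcongr; exact ContinuousLinearMap.le_opNorm _ _
    _ = _ := by ring

lemma bilinBound_diagonal {d : ℕ} {D : Fin d → ℝ} {m : ℝ} (hm : 0 ≤ m) (hD : ∀ k, |D k| ≤ m) :
    BilinBound (Matrix.diagonal D) m := by
  intro u v
  calc |u ⬝ᵥ (Matrix.diagonal D *ᵥ v)| ≤ ∑ k, m * (|u k| * |v k|) := by
        refine (Finset.abs_sum_le_sum_abs _ _).trans (Finset.sum_le_sum fun k _ => ?_)
        rw [Matrix.mulVec_diagonal, abs_mul, abs_mul]
        have := mul_le_mul_of_nonneg_right (hD k) (mul_nonneg (abs_nonneg (u k)) (abs_nonneg (v k)))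
        linarith
    _ ≤ _ := by
        rw [← Finset.mul_sum]
        exact mul_le_mul_of_nonneg_left (sum_abs_mul_le u v) hm

lemma abs_dotProduct_mul_dotProduct_le {d : ℕ} (a u v : Fin d → ℝ) :
    |(u ⬝ᵥ a) * (v ⬝ᵥ a)| ≤ (a ⬝ᵥ a) * (√(u ⬝ᵥ u) * √(v ⬝ᵥ v)) := by
  rw [abs_mul]
  calc _ ≤ (√(u ⬝ᵥ u) * √(a ⬝ᵥ a)) * (√(v ⬝ᵥ v) * √(a ⬝ᵥ a)) :=
        mul_le_mul (abs_dotProduct_le u a) (abs_dotProduct_le v a) (abs_nonneg _) (by positivity)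
    _ = (√(a ⬝ᵥ a) * √(a ⬝ᵥ a)) * (√(u ⬝ᵥ u) * √(v ⬝ᵥ v)) := by ring
    _ = _ := by rw [Real.mul_self_sqrt (dotProduct_self_real_nonneg a)]

lemma bilinBound_vecMulVec {d : ℕ} (a : Fin d → ℝ) : BilinBound (vecMulVec a a) (a ⬝ᵥ a) := by
  intro u v
  have : u ⬝ᵥ (vecMulVec a a *ᵥ v) = (u ⬝ᵥ a) * (v ⬝ᵥ a) := by
    simp only [dotProduct, mulVec, vecMulVec_apply, Finset.sum_mul, Finset.mul_sum]
    rw [Finset.sum_comm]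
    refine Finset.sum_congr rfl fun l _ => Finset.sum_congr rfl fun k _ => by ring
  rw [this]
  exact abs_dotProduct_mul_dotProduct_le a u v

lemma bilinBound_secondMoment {n d : ℕ} (x : Fin n → Fin d → ℝ) :
    BilinBound (secondMoment x) ((1 / (n : ℝ)) * ∑ i, x i ⬝ᵥ x i) := by
  intro u v
  rw [dotProduct_secondMoment_mulVec, abs_mul, abs_of_nonneg (by positivity), mul_assoc]
  refine mul_le_mul_of_nonneg_left ?_ (by positivity)
  rw [Finset.sum_mul]
  exact (Finset.abs_sum_le_sum_abs _ _).trans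
    (Finset.sum_le_sum fun i _ => abs_dotProduct_mul_dotProduct_le _ _ _)

/-- The sample mean. -/
def sampleMean {n d : ℕ} (x : Fin n → Fin d → ℝ) : Fin d → ℝ :=
  fun k => (1 / (n : ℝ)) * ∑ i, x i k

lemma sum_sum_erase_mul {n d : ℕ} (x : Fin n → Fin d → ℝ) (k l : Fin d) :
    ∑ i, ∑ j ∈ Finset.univ.erase i, x i k * x j l =
      (∑ i, x i k) * (∑ j, x j l) - ∑ i, x i k * x i l := by
  rw [Finset.sum_mul_sum, ← Finset.sum_sub_distrib]
  exact Finset.sum_congr rfl fun i _ => Finset.sum_erase_eq_sub (Finset.mem_univ i)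

lemma contrastMatrix_transpose {n d : ℕ} (x : Fin n → Fin d → ℝ) :
    (contrastMatrix x)ᵀ = contrastMatrix x := by
  ext k l
  have h1 : ∑ i, x i l * x i k = ∑ i, x i k * x i l :=
    Finset.sum_congr rfl fun i _ => mul_comm _ _
  simp only [Matrix.transpose_apply, contrastMatrix, Matrix.of_apply, sum_sum_erase_mul, h1,
    eq_comm (a := l) (b := k), mul_comm (∑ i, x i l) (∑ i, x i k)]

/-- Deleting the diagonal cancels `D`, whatever it is, at the price of `q` times the diagonal of
`P`. The sum over distinct pairs is the full double sum minus its diagonal, which produces the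
sample mean and the extra multiple of `secondMoment x`. -/
lemma contrastMatrix_eq {n d : ℕ} (hn : 2 ≤ n) (x : Fin n → Fin d → ℝ)
    (P : Matrix (Fin d) (Fin d) ℝ) (q : ℝ) (D : Fin d → ℝ) :
    contrastMatrix x - q • P =
      (secondMoment x - (q • P + Matrix.diagonal D)) -
      Matrix.diagonal (fun k => (secondMoment x - (q • P + Matrix.diagonal D)) k k) -
      q • Matrix.diagonal (fun k => P k k) -
      ((n : ℝ) / (n - 1)) • vecMulVec (sampleMean x) (sampleMean x) +
      (1 / ((n : ℝ) - 1)) • secondMoment x := by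
  have hn0 : (n : ℝ) ≠ 0 := by positivity
  have hn1 : (n : ℝ) - 1 ≠ 0 := by
    have : (2 : ℝ) ≤ n := by exact_mod_cast hn
    linarith
  ext k l
  simp only [contrastMatrix, secondMoment, sampleMean, Matrix.sub_apply, Matrix.add_apply,
    Matrix.smul_apply, Matrix.of_apply, vecMulVec_apply, smul_eq_mul, Matrix.diagonal_apply,
    sum_sum_erase_mul]
  by_cases h : k = l
  · subst h
    simp only [if_true]
    field_simp
    ring
  · simp only [h, if_false]
    field_simp
    ring

/-- The term `2 * b` pays for the error and for its diagonal, whose entries are bounded by the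
operator norm. The other factors `2` come from `n / (n - 1) ≤ 2` for `n ≥ 2`. -/
lemma bilinBound_contrastMatrix_sub {n d : ℕ} (hn : 2 ≤ n) (x : Fin n → Fin d → ℝ)
    (P : Matrix (Fin d) (Fin d) ℝ) {q : ℝ} (hq : 0 ≤ q) (D : Fin d → ℝ) {m b : ℝ} (hm : 0 ≤ m)
    (hP : ∀ k, |P k k| ≤ m)
    (hb : ‖toEuclideanCLM (𝕜 := ℝ) (secondMoment x - (q • P + Matrix.diagonal D))‖ ≤ b) :
    BilinBound (contrastMatrix x - q • P)
      (2 * b + q * m + 2 * (sampleMean x ⬝ᵥ sampleMean x) +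
        2 / (n : ℝ) * ((1 / (n : ℝ)) * ∑ i, x i ⬝ᵥ x i)) := by
  have hB := (bilinBound_norm (secondMoment x - (q • P + Matrix.diagonal D))).mono hb
  have hb0 : 0 ≤ b := (norm_nonneg _).trans hb
  have h2 : (2 : ℝ) ≤ n := by exact_mod_cast hn
  rw [contrastMatrix_eq hn x P q D]
  refine ((((hB.sub (bilinBound_diagonal hb0 hB.abs_apply_le)).sub
    ((bilinBound_diagonal hm hP).smul q)).sub ((bilinBound_vecMulVec (sampleMean x)).smul _)).add
    ((bilinBound_secondMoment x).smul _)).mono ?_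
  have h3 : |(n : ℝ) / (n - 1)| ≤ 2 := by
    rw [abs_of_nonneg (div_nonneg (by linarith) (by linarith)), div_le_iff₀ (by linarith)]
    linarith
  have h4 : |1 / ((n : ℝ) - 1)| ≤ 2 / n := by
    rw [abs_of_nonneg (div_nonneg (by linarith) (by linarith)),
      div_le_div_iff₀ (by linarith) (by linarith)]
    linarith
  have h5 : 0 ≤ (1 / (n : ℝ)) * ∑ i, x i ⬝ᵥ x i :=
    mul_nonneg (by positivity) (Finset.sum_nonneg fun i _ => dotProduct_self_real_nonneg _)
  rw [abs_of_nonneg hq, two_mul b]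
  gcongr
  exact dotProduct_self_real_nonneg _

/-! ### Moments of the spiked sample -/

section Sample

lemma dotProduct_observed {Ω : Type*} {n d r : ℕ} (U : Matrix (Fin d) (Fin r) ℝ) (z : Fin n → Ω → Fin r → ℝ)
    (ξ : Fin n → Ω → Fin d → ℝ) (u : Fin d → ℝ) (i : Fin n) (ω : Ω) :
    u ⬝ᵥ observed U z ξ ω i = (Uᵀ *ᵥ u) ⬝ᵥ z i ω + u ⬝ᵥ ξ i ω := by
  unfold observed
  rw [dotProduct_add, Matrix.dotProduct_mulVec, ← Matrix.mulVec_transpose]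

variable {Ω : Type*} [MeasurableSpace Ω] {μ : Measure Ω}

lemma IsSubGaussianVec.memLp_apply {m : ℕ} {v : Ω → Fin m → ℝ} {c : ℝ}
    (h : IsSubGaussianVec μ v c) (k : Fin m) : MemLp (fun ω => v ω k) 2 μ := by
  have := (h (Pi.single k 1)).memLp 2
  simpa using this

/-- Second moments of linear forms of a centred vector with given covariance. -/
lemma integral_dotProduct_mul_dotProduct {m : ℕ} [IsProbabilityMeasure μ] {v : Ω → Fin m → ℝ}
    (hv : ∀ k, MemLp (fun ω => v ω k) 2 μ) (hmean : ∀ k, ∫ ω, v ω k ∂μ = 0) {D : Fin m → ℝ}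
    (hcov : ∀ k l, covariance (fun ω => v ω k) (fun ω => v ω l) μ = if k = l then D k else 0)
    (a b : Fin m → ℝ) :
    ∫ ω, (a ⬝ᵥ v ω) * (b ⬝ᵥ v ω) ∂μ = ∑ k, a k * b k * D k := by
  have hint : ∀ k l, Integrable (fun ω => a k * b l * (v ω k * v ω l)) μ := fun k l =>
    ((hv k).integrable_mul (hv l)).const_mul _
  have hkl : ∀ k l, ∫ ω, v ω k * v ω l ∂μ = if k = l then D k else 0 := fun k l => by
    rw [← hcov k l, covariance_eq_sub (hv k) (hv l), hmean k, hmean l]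
    simp
  have e : ∀ ω, (a ⬝ᵥ v ω) * (b ⬝ᵥ v ω) = ∑ k, ∑ l, a k * b l * (v ω k * v ω l) := fun ω => by
    simp only [dotProduct, Finset.sum_mul_sum]
    exact Finset.sum_congr rfl fun k _ => Finset.sum_congr rfl fun l _ => by ring
  simp_rw [e]
  rw [integral_finsetSum _ fun k _ => integrable_finsetSum _ fun l _ => hint k l]
  refine Finset.sum_congr rfl fun k _ => ?_
  rw [integral_finsetSum _ fun l _ => hint k l]
  simp [integral_const_mul, hkl]

lemma integral_dotProduct_eq_zero {m : ℕ} {v : Ω → Fin m → ℝ}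
    (hv : ∀ k, Integrable (fun ω => v ω k) μ) (hmean : ∀ k, ∫ ω, v ω k ∂μ = 0) (a : Fin m → ℝ) :
    ∫ ω, a ⬝ᵥ v ω ∂μ = 0 := by
  simp only [dotProduct]
  rw [integral_finsetSum _ fun k _ => (hv k).const_mul _]
  simp [integral_const_mul, hmean]

lemma measurable_dotProduct_left {m : ℕ} (a : Fin m → ℝ) :
    Measurable fun y : Fin m → ℝ => a ⬝ᵥ y := by
  unfold dotProduct; fun_prop

lemma dotProduct_transpose_mulVec_self_le {d r : ℕ} {U : Matrix (Fin d) (Fin r) ℝ}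
    (hU : IsOrthonormalCols U) (u : Fin d → ℝ) : (Uᵀ *ᵥ u) ⬝ᵥ (Uᵀ *ᵥ u) ≤ u ⬝ᵥ u := by
  have h := dotProduct_self_real_nonneg (u - U *ᵥ (Uᵀ *ᵥ u))
  have h1 : u ⬝ᵥ (U *ᵥ (Uᵀ *ᵥ u)) = (Uᵀ *ᵥ u) ⬝ᵥ (Uᵀ *ᵥ u) := by
    rw [Matrix.dotProduct_mulVec, ← Matrix.mulVec_transpose]
  have h2 : (U *ᵥ (Uᵀ *ᵥ u)) ⬝ᵥ (U *ᵥ (Uᵀ *ᵥ u)) = (Uᵀ *ᵥ u) ⬝ᵥ (Uᵀ *ᵥ u) := by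
    rw [Matrix.dotProduct_mulVec, ← Matrix.mulVec_transpose, Matrix.mulVec_mulVec (Uᵀ *ᵥ u), hU,
      Matrix.one_mulVec]
  rw [sub_dotProduct, dotProduct_sub, dotProduct_sub, h1, h2,
    dotProduct_comm (U *ᵥ (Uᵀ *ᵥ u)) u, h1] at h
  linarith

namespace IsSpikedSample

variable {n d r : ℕ} {K ν : ℝ} {σ : Fin d → ℝ} {z : Fin n → Ω → Fin r → ℝ}
  {ξ : Fin n → Ω → Fin d → ℝ} {U : Matrix (Fin d) (Fin r) ℝ}

lemma measurable_mulVec_add (U : Matrix (Fin d) (Fin r) ℝ) :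
    Measurable fun p : (Fin r → ℝ) × (Fin d → ℝ) => U *ᵥ p.1 + p.2 := by
  refine measurable_pi_lambda _ fun k => ?_
  simp only [Pi.add_apply, mulVec, dotProduct]
  fun_prop

lemma measurable_observed (h : IsSpikedSample μ K ν σ z ξ) (U : Matrix (Fin d) (Fin r) ℝ)
    (i : Fin n) : Measurable fun ω => observed U z ξ ω i :=
  (measurable_mulVec_add U).comp ((h.measurable_z i).prodMk (h.measurable_noise i))

lemma iIndepFun_observed (h : IsSpikedSample μ K ν σ z ξ) (U : Matrix (Fin d) (Fin r) ℝ) :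
    iIndepFun (fun i ω => observed U z ξ ω i) μ :=
  h.iIndep.comp (fun _ p => U *ᵥ p.1 + p.2) fun _ => measurable_mulVec_add U

/-- The signal and noise parts of a linear form are independent, so their variance proxies add, and
`Uᵀ` is a contraction. Replacing `K` by `max K 1` keeps the scale positive for every real `K`. -/
lemma hasSqExpBound [IsProbabilityMeasure μ] (h : IsSpikedSample μ K ν σ z ξ)
    (hU : IsOrthonormalCols U) {s : ℝ} (hs : 0 ≤ s)
    (hsK : s * (max K 1 * (ν ^ 2 + sigmaMax σ ^ 2)) ≤ 3 / 8) (i : Fin n) {u : Fin d → ℝ}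
    (hu : u ⬝ᵥ u ≤ 1) : HasSqExpBound (fun ω => u ⬝ᵥ observed U z ξ ω i) s μ := by
  have hind : IndepFun (fun ω => (Uᵀ *ᵥ u) ⬝ᵥ z i ω) (fun ω => u ⬝ᵥ ξ i ω) μ :=
    (h.indep i).comp (measurable_dotProduct_left (Uᵀ *ᵥ u)) (measurable_dotProduct_left u)
  have hsub := HasSubgaussianMGF.add_of_indepFun (h.subGaussian_z i (Uᵀ *ᵥ u))
    (h.subGaussian_noise i u) hind
  simp only [dotProduct_observed]
  refine hasSqExpBound_of_hasSubgaussianMGF hsub hs (le_trans ?_ hsK)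
  refine mul_le_mul_of_nonneg_left ?_ hs
  have hle : ∀ q t : ℝ, 0 ≤ t → t ≤ 1 → max (K * q ^ 2 * t) 0 ≤ max K 1 * q ^ 2 := by
    intro q t ht0 ht1
    have hK : 0 ≤ max K 1 := zero_le_one.trans (le_max_right _ _)
    refine max_le ?_ (by positivity)
    calc K * q ^ 2 * t ≤ max K 1 * q ^ 2 * t := by gcongr; exact le_max_left _ _
      _ ≤ max K 1 * q ^ 2 * 1 := by gcongr
      _ = _ := mul_one _
  rw [NNReal.coe_add, Real.coe_toNNReal', Real.coe_toNNReal', mul_add]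
  exact add_le_add (hle _ _ (dotProduct_self_real_nonneg _)
    ((dotProduct_transpose_mulVec_self_le hU u).trans hu)) (hle _ _ (dotProduct_self_real_nonneg _) hu)

lemma integral_observed_eq_zero (h : IsSpikedSample μ K ν σ z ξ) [IsProbabilityMeasure μ]
    (i : Fin n) (u : Fin d → ℝ) : ∫ ω, u ⬝ᵥ observed U z ξ ω i ∂μ = 0 := by
  simp only [dotProduct_observed]
  rw [integral_add (h.subGaussian_z i _).integrable (h.subGaussian_noise i _).integrable,
    integral_dotProduct_eq_zero
      (fun k => ((h.subGaussian_z i).memLp_apply k).integrable one_le_two) (h.mean_z i),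
    integral_dotProduct_eq_zero
      (fun k => ((h.subGaussian_noise i).memLp_apply k).integrable one_le_two) (h.mean_noise i),
    add_zero]

/-- The cross terms vanish by independence and `E z = 0`, leaving signal plus diagonal noise. -/
lemma integral_observed_mul_observed (h : IsSpikedSample μ K ν σ z ξ) [IsProbabilityMeasure μ]
    (i : Fin n) (u v : Fin d → ℝ) :
    ∫ ω, (u ⬝ᵥ observed U z ξ ω i) * (v ⬝ᵥ observed U z ξ ω i) ∂μ =
      u ⬝ᵥ ((ν ^ 2 • (U * Uᵀ) + Matrix.diagonal fun k => σ k ^ 2) *ᵥ v) := by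
  have hz : ∀ a : Fin r → ℝ, MemLp (fun ω => a ⬝ᵥ z i ω) 2 μ := fun a =>
    (h.subGaussian_z i a).memLp 2
  have hξ : ∀ a : Fin d → ℝ, MemLp (fun ω => a ⬝ᵥ ξ i ω) 2 μ := fun a =>
    (h.subGaussian_noise i a).memLp 2
  have hcross : ∀ (a : Fin r → ℝ) (b : Fin d → ℝ),
      ∫ ω, (a ⬝ᵥ z i ω) * (b ⬝ᵥ ξ i ω) ∂μ = 0 := by
    intro a b
    have hind : IndepFun (fun ω => a ⬝ᵥ z i ω) (fun ω => b ⬝ᵥ ξ i ω) μ :=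
      (h.indep i).comp (measurable_dotProduct_left a) (measurable_dotProduct_left b)
    rw [hind.integral_fun_mul_eq_mul_integral (hz a).aestronglyMeasurable
      (hξ b).aestronglyMeasurable, integral_dotProduct_eq_zero
      (fun k => ((h.subGaussian_z i).memLp_apply k).integrable one_le_two) (h.mean_z i), zero_mul]
  set a := Uᵀ *ᵥ u with ha
  set b := Uᵀ *ᵥ v with hb
  have e : ∀ ω, (u ⬝ᵥ observed U z ξ ω i) * (v ⬝ᵥ observed U z ξ ω i) =
      (a ⬝ᵥ z i ω) * (b ⬝ᵥ z i ω) + (a ⬝ᵥ z i ω) * (v ⬝ᵥ ξ i ω) +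
        ((b ⬝ᵥ z i ω) * (u ⬝ᵥ ξ i ω) + (u ⬝ᵥ ξ i ω) * (v ⬝ᵥ ξ i ω)) := fun ω => by
    rw [dotProduct_observed, dotProduct_observed]; ring
  have i1 : Integrable (fun ω => (a ⬝ᵥ z i ω) * (b ⬝ᵥ z i ω)) μ := (hz a).integrable_mul (hz b)
  have i2 : Integrable (fun ω => (a ⬝ᵥ z i ω) * (v ⬝ᵥ ξ i ω)) μ := (hz a).integrable_mul (hξ v)
  have i3 : Integrable (fun ω => (b ⬝ᵥ z i ω) * (u ⬝ᵥ ξ i ω)) μ := (hz b).integrable_mul (hξ u)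
  have i4 : Integrable (fun ω => (u ⬝ᵥ ξ i ω) * (v ⬝ᵥ ξ i ω)) μ := (hξ u).integrable_mul (hξ v)
  simp only [e]
  rw [integral_add (f := fun ω => (a ⬝ᵥ z i ω) * (b ⬝ᵥ z i ω) + (a ⬝ᵥ z i ω) * (v ⬝ᵥ ξ i ω))
    (g := fun ω => (b ⬝ᵥ z i ω) * (u ⬝ᵥ ξ i ω) + (u ⬝ᵥ ξ i ω) * (v ⬝ᵥ ξ i ω))
    (i1.add i2) (i3.add i4), integral_add i1 i2, integral_add i3 i4, hcross, hcross,
    integral_dotProduct_mul_dotProduct (D := fun _ => ν ^ 2) (h.subGaussian_z i).memLp_apply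
      (h.mean_z i) (h.cov_z i),
    integral_dotProduct_mul_dotProduct (D := fun k => σ k ^ 2) (h.subGaussian_noise i).memLp_apply
      (h.mean_noise i) (h.cov_noise i)]
  rw [Matrix.add_mulVec, Matrix.smul_mulVec, dotProduct_add, dotProduct_smul,
    ← Matrix.mulVec_mulVec, Matrix.dotProduct_mulVec u U, ← Matrix.mulVec_transpose, ← ha, ← hb]
  simp only [← Finset.sum_mul, smul_eq_mul, dotProduct, Matrix.mulVec_diagonal, add_zero, zero_add]
  rw [mul_comm]
  congr 1
  exact Finset.sum_congr rfl fun k _ => by ring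

end IsSpikedSample

lemma dotProduct_self_eq_sum_single {d : ℕ} (y : Fin d → ℝ) :
    y ⬝ᵥ y = ∑ k, (Pi.single k 1 ⬝ᵥ y) ^ 2 := by
  simp only [single_one_dotProduct]
  simp only [dotProduct, sq]

lemma single_dotProduct_single_le {d : ℕ} (k : Fin d) :
    (Pi.single k (1 : ℝ) : Fin d → ℝ) ⬝ᵥ Pi.single k 1 ≤ 1 := by simp

lemma integrable_and_integral_dotProduct_self_le [IsProbabilityMeasure μ] {d : ℕ}
    {y : Ω → Fin d → ℝ} {s : ℝ}
    (hs : 0 < s) (hy : ∀ u, u ⬝ᵥ u ≤ 1 → HasSqExpBound (fun ω => u ⬝ᵥ y ω) s μ) :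
    Integrable (fun ω => y ω ⬝ᵥ y ω) μ ∧ ∫ ω, y ω ⬝ᵥ y ω ∂μ ≤ d / s := by
  have hk := fun k : Fin d => hy (Pi.single k 1) (single_dotProduct_single_le k)
  simp only [dotProduct_self_eq_sum_single (y _)]
  refine ⟨integrable_finsetSum _ fun k _ => (hk k).integrable_sq hs, ?_⟩
  rw [integral_finsetSum _ fun k _ => (hk k).integrable_sq hs]
  calc _ ≤ ∑ _k : Fin d, 1 / s := Finset.sum_le_sum fun k _ => (hk k).integral_sq_le hs
    _ = d / s := by simp; ring

/-- The expected squared norm of the mean of centred independent vectors. -/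
lemma integrable_and_integral_sampleMean_le [IsProbabilityMeasure μ] {n d : ℕ} (hn : 0 < n)
    {x : Fin n → Ω → Fin d → ℝ} (hindep : iIndepFun x μ) {s : ℝ} (hs : 0 < s)
    (hx : ∀ i u, u ⬝ᵥ u ≤ 1 → HasSqExpBound (fun ω => u ⬝ᵥ x i ω) s μ)
    (hmean : ∀ i u, ∫ ω, u ⬝ᵥ x i ω ∂μ = 0) :
    Integrable (fun ω => sampleMean (fun i => x i ω) ⬝ᵥ sampleMean (fun i => x i ω)) μ ∧
      ∫ ω, sampleMean (fun i => x i ω) ⬝ᵥ sampleMean (fun i => x i ω) ∂μ ≤ d / n / s := by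
  have hn' : (0 : ℝ) < n := by exact_mod_cast hn
  have hk := fun i (k : Fin d) => hx i (Pi.single k 1) (single_dotProduct_single_le k)
  have hmem := fun i (k : Fin d) => (hk i k).memLp_two hs
  have hk0 := fun i (k : Fin d) => hmean i (Pi.single k 1)
  simp only [single_one_dotProduct] at hk hmem hk0
  have hsum : ∀ k, MemLp (∑ i, fun ω => x i ω k) 2 μ := fun k =>
    memLp_finsetSum' _ fun i _ => hmem i k
  have hvar : ∀ k, ∫ ω, (∑ i, fun ω => x i ω k) ω ^ 2 ∂μ ≤ n / s := by
    intro k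
    have hz : ∫ ω, (∑ i, fun ω => x i ω k) ω ∂μ = 0 := by
      simp only [Finset.sum_apply]
      rw [integral_finsetSum _ fun i _ => (hmem i k).integrable one_le_two]
      simp [hk0]
    -- Independence makes the variances add, so the sum grows like `n` rather than `n²`.
    rw [← variance_of_integral_eq_zero (hsum k).aemeasurable hz,
      IndepFun.variance_sum (fun i _ => hmem i k) fun i _ j _ hij =>
        (hindep.indepFun hij).comp (measurable_pi_apply k) (measurable_pi_apply k)]
    calc _ ≤ ∑ _i : Fin n, 1 / s := Finset.sum_le_sum fun i _ => by
          rw [variance_of_integral_eq_zero (hmem i k).aemeasurable (hk0 i k)]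
          exact (hk i k).integral_sq_le hs
      _ = n / s := by simp; ring
  have e : ∀ ω, sampleMean (fun i => x i ω) ⬝ᵥ sampleMean (fun i => x i ω) =
      ∑ k, (1 / (n : ℝ)) ^ 2 * (∑ i, fun ω => x i ω k) ω ^ 2 := fun ω => by
    simp only [sampleMean, dotProduct, Finset.sum_apply]
    exact Finset.sum_congr rfl fun k _ => by ring
  have hint : ∀ k, Integrable (fun ω => (1 / (n : ℝ)) ^ 2 * (∑ i, fun ω => x i ω k) ω ^ 2) μ :=
    fun k => (hsum k).integrable_sq.const_mul _
  simp only [e]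
  refine ⟨integrable_finsetSum _ fun k _ => hint k, ?_⟩
  rw [integral_finsetSum _ fun k _ => hint k]
  calc _ ≤ ∑ _k : Fin d, (1 / (n : ℝ)) ^ 2 * (n / s) := Finset.sum_le_sum fun k _ => by
        rw [integral_const_mul]
        exact mul_le_mul_of_nonneg_left (hvar k) (by positivity)
    _ = d / n / s := by
        simp only [Finset.sum_const, Finset.card_univ, Fintype.card_fin, nsmul_eq_mul]
        field_simp

/-- An integrable bound for the deviation of the contrast matrix of a spiked sample from the
signal, with small expectation. -/
lemma IsSpikedSample.exists_bilinBound [IsProbabilityMeasure μ] {n d r : ℕ} {K ν : ℝ}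
    {σ : Fin d → ℝ} {z : Fin n → Ω → Fin r → ℝ} {ξ : Fin n → Ω → Fin d → ℝ}
    {U : Matrix (Fin d) (Fin r) ℝ} (h : IsSpikedSample μ K ν σ z ξ) (hU : IsOrthonormalCols U)
    (hd : 0 < d) (hdn : d < n) {s m : ℝ} (hs : 0 < s)
    (hsK : s * (max K 1 * (ν ^ 2 + sigmaMax σ ^ 2)) ≤ 3 / 8) (hm : 0 ≤ m)
    (hP : ∀ k, |(U * Uᵀ) k k| ≤ m) :
    ∃ F : Ω → ℝ, Integrable F μ ∧ ∫ ω, F ω ∂μ ≤ 564 / s * √(d / n) + ν ^ 2 * m ∧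
      ∀ ω, BilinBound (contrastMatrix (observed U z ξ ω) - ν ^ 2 • (U * Uᵀ)) (F ω) := by
  have hn : 0 < n := hd.trans hdn
  have hn' : (0 : ℝ) < n := by exact_mod_cast hn
  have hx : ∀ i u, u ⬝ᵥ u ≤ 1 → HasSqExpBound (fun ω => u ⬝ᵥ observed U z ξ ω i) s μ :=
    fun i u hu => h.hasSqExpBound hU hs.le hsK i hu
  obtain ⟨G, hGint, hGle, hG⟩ := exists_integrable_bound_norm_secondMoment_sub hd hdn.le
    (h.measurable_observed U) (h.iIndepFun_observed U) h.integral_observed_mul_observed hs hx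
  obtain ⟨h1int, h1le⟩ := integrable_and_integral_sampleMean_le hn (h.iIndepFun_observed U) hs hx
    h.integral_observed_eq_zero
  have h2 := fun i => integrable_and_integral_dotProduct_self_le hs (hx i)
  have h2int : Integrable (fun ω => (1 / (n : ℝ)) *
      ∑ i, observed U z ξ ω i ⬝ᵥ observed U z ξ ω i) μ :=
    (integrable_finsetSum _ fun i _ => (h2 i).1).const_mul _
  have h2le : ∫ ω, (1 / (n : ℝ)) * ∑ i, observed U z ξ ω i ⬝ᵥ observed U z ξ ω i ∂μ ≤ d / s := by
    rw [integral_const_mul, integral_finsetSum _ fun i _ => (h2 i).1]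
    calc _ ≤ (1 / (n : ℝ)) * ∑ _i : Fin n, d / s :=
          mul_le_mul_of_nonneg_left (Finset.sum_le_sum fun i _ => (h2 i).2) (by positivity)
      _ = d / s := by
          simp only [Finset.sum_const, Finset.card_univ, Fintype.card_fin, nsmul_eq_mul]
          field_simp
  refine ⟨fun ω => 2 * G ω + ν ^ 2 * m +
      2 * (sampleMean (observed U z ξ ω) ⬝ᵥ sampleMean (observed U z ξ ω)) +
        2 / (n : ℝ) * ((1 / (n : ℝ)) * ∑ i, observed U z ξ ω i ⬝ᵥ observed U z ξ ω i),
    (((hGint.const_mul 2).add (integrable_const _)).add (h1int.const_mul 2)).add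
      (h2int.const_mul _), ?_, fun ω => ?_⟩
  · rw [integral_add (f := fun ω => 2 * G ω + ν ^ 2 * m +
        2 * (sampleMean (observed U z ξ ω) ⬝ᵥ sampleMean (observed U z ξ ω)))
        (((hGint.const_mul 2).add (integrable_const _)).add (h1int.const_mul 2))
        (h2int.const_mul _),
      integral_add (f := fun ω => 2 * G ω + ν ^ 2 * m)
        ((hGint.const_mul 2).add (integrable_const _)) (h1int.const_mul 2),
      integral_add (hGint.const_mul 2) (integrable_const _), integral_const_mul 2,
      integral_const_mul 2, integral_const_mul (2 / (n : ℝ)), integral_const, probReal_univ, one_smul]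
    -- As `d ≤ n`, the terms of order `d / n` are absorbed in the main rate: `2 * 280 + 2 + 2 =
    -- 564`.
    have hdn1 : (d : ℝ) / n ≤ √(d / n) := by
      have h01 : (d : ℝ) / n ≤ 1 := (div_le_one hn').2 (by exact_mod_cast hdn.le)
      have h0 : (0 : ℝ) ≤ d / n := by positivity
      exact Real.le_sqrt_of_sq_le (by nlinarith)
    have h3 : (d : ℝ) / n / s ≤ 1 / s * √(d / n) := by
      rw [div_eq_mul_one_div, mul_comm]
      gcongr
    have h4 : 2 / (n : ℝ) * (d / s) = 2 * (d / n / s) := by field_simp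
    have h5 := mul_le_mul_of_nonneg_left h2le (show 0 ≤ 2 / (n : ℝ) by positivity)
    calc _ ≤ 2 * (280 / s * √(d / n)) + ν ^ 2 * m + 2 * (1 / s * √(d / n)) +
          2 * (1 / s * √(d / n)) := by linarith
      _ = _ := by ring
  · exact bilinBound_contrastMatrix_sub (by omega) _ _ (sq_nonneg ν) _ hm hP (hG ω)

end Sample

/-! ### Assembling the rate -/

lemma abs_mul_transpose_apply_le_incoherence {d r : ℕ} (U : Matrix (Fin d) (Fin r) ℝ) (k : Fin d) :
    |(U * Uᵀ) k k| ≤ incoherence U := by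
  have e : (U * Uᵀ) k k = ∑ j, U k j ^ 2 := by
    simp [Matrix.mul_apply, sq]
  rw [e, abs_of_nonneg (Finset.sum_nonneg fun _ _ => sq_nonneg _)]
  exact le_ciSup (f := fun k => ∑ j, U k j ^ 2) (Set.finite_range _).bddAbove k

/-- For `d = 0` the supremum over an empty family is `0`, and division by zero makes the signal to
noise ratio `0`, contradicting `c > 0`. -/
lemma sigmaMax_pos_of_le_snr {d : ℕ} {c ν : ℝ} {σ : Fin d → ℝ} (hc : 0 < c) (hσ : ∀ k, 0 < σ k)
    (h : c ≤ snr ν σ) : 0 < d ∧ 0 < sigmaMax σ := by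
  rcases Nat.eq_zero_or_pos d with rfl | hd
  · have : sigmaMax σ = 0 := Real.iSup_of_isEmpty _
    rw [snr, this, div_zero] at h
    linarith
  · exact ⟨hd, (hσ ⟨0, hd⟩).trans_le
      (le_ciSup (f := σ) (Set.finite_range _).bddAbove (⟨0, hd⟩ : Fin d))⟩

lemma aemeasurable_sinTheta {Ω : Type*} [MeasurableSpace Ω] {μ : Measure Ω} {d r : ℕ}
    (Us : Matrix (Fin d) (Fin r) ℝ) {U : Ω → Matrix (Fin d) (Fin r) ℝ}
    (hU : ∀ k j, AEMeasurable (fun ω => U ω k j) μ) :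
    AEMeasurable (fun ω => sinTheta Us (U ω)) μ := by
  unfold sinTheta frobNorm
  simp only [Matrix.mul_apply]
  exact (Finset.aemeasurable_fun_sum _ fun i _ => Finset.aemeasurable_fun_sum _ fun j _ =>
    (Finset.aemeasurable_fun_sum _ fun k _ => (hU k j).const_mul _).pow_const 2).sqrt

/-- Realization by realization, the minimizers are controlled by any bilinear bound on the
deviation of the contrast matrix from the signal. -/
lemma sinTheta_le_of_isCLSolution {n d r : ℕ} (hn : 2 ≤ n) {lam q ε : ℝ} (hlam : 0 < lam)
    (hq : 0 < q) {x : Fin n → Fin d → ℝ} {Us : Matrix (Fin d) (Fin r) ℝ}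
    (hUs : IsOrthonormalCols Us) (hd : 0 < d) (hE : BilinBound (contrastMatrix x - q • (Us * Usᵀ)) ε)
    {W : Matrix (Fin r) (Fin d) ℝ} {U : Matrix (Fin d) (Fin r) ℝ} {s : Fin r → ℝ}
    {V : Matrix (Fin r) (Fin r) ℝ} (hW : IsCLSolution lam x W) (h : IsSVD W U s V) :
    sinTheta Us U ≤ √r * (2 * ε / q) := by
  have hε : 0 ≤ ε := (abs_nonneg _).trans (hE.abs_apply_le ⟨0, hd⟩)
  refine sinTheta_le_of_minimizer hlam hq hε (contrastMatrix_transpose x) hUs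
    (fun u v => (le_abs_self _).trans (hE u v)) (fun W' => ?_) h
  have := hW W'
  rwa [maskedLoss_eq hn, maskedLoss_eq hn] at this

/-- The signal strength `q` cancels; `√r` turns `√(d/n)` into `√(dr/n)` and the incoherence rate `r
log d / d` into `r ^ (3/2) log d / d`. -/
lemma sqrt_mul_rate_le {n d r : ℕ} {A q I CI : ℝ} (hq : 0 < q)
    (hI : I ≤ CI * (r * Real.log d / d)) (hA : 0 ≤ A) :
    √r * (2 / q) * (A * q * √(d / n) + q * I) ≤
      (2 * A + 2 * |CI| + 1) * ((r : ℝ) ^ (3 / 2 : ℝ) / d * Real.log d + √(d * r / n)) := by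
  have hlog : 0 ≤ Real.log d := Real.log_natCast_nonneg d
  have hX : 0 ≤ (r : ℝ) * Real.log d / d := by positivity
  have hI' : I ≤ |CI| * (r * Real.log d / d) :=
    hI.trans (mul_le_mul_of_nonneg_right (le_abs_self CI) hX)
  have h1 : √(r : ℝ) * √(d / n) = √(d * r / n) := by
    rw [← Real.sqrt_mul (Nat.cast_nonneg r)]; congr 1; ring
  have h2 : √(r : ℝ) * (r * Real.log d / d) = (r : ℝ) ^ (3 / 2 : ℝ) / d * Real.log d := by
    have : (r : ℝ) ^ (3 / 2 : ℝ) = √r * r := by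
      rw [show (3 / 2 : ℝ) = 1 / 2 + 1 by norm_num,
        Real.rpow_add_one' (Nat.cast_nonneg r) (by norm_num), Real.sqrt_eq_rpow]
    rw [this]; ring
  have h3 : 0 ≤ √((d : ℝ) * r / n) := Real.sqrt_nonneg _
  have h4 : 0 ≤ (r : ℝ) ^ (3 / 2 : ℝ) / d * Real.log d := by positivity
  have h5 : 0 ≤ |CI| := abs_nonneg CI
  calc √r * (2 / q) * (A * q * √(d / n) + q * I)
      = 2 * A * (√r * √(d / n)) + 2 * (√r * I) := by field_simp
    _ ≤ 2 * A * (√r * √(d / n)) + 2 * (√r * (|CI| * (r * Real.log d / d))) := by gcongr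
    _ = 2 * A * √(d * r / n) + 2 * |CI| * ((r : ℝ) ^ (3 / 2 : ℝ) / d * Real.log d) := by
        rw [h1, ← h2]; ring
    _ ≤ _ := by nlinarith [mul_nonneg hA h4, mul_nonneg h5 h3]

end

end SpikedCL

theorem theorem3p2 (Cκ c₁ c₂ CI K : ℝ) (hc₁ : 0 < c₁) :
    ∃ C : ℝ, 0 < C ∧
      ∀ (n d r : ℕ), 0 < r → d < n →
      ∀ (lam ν : ℝ) (σ : Fin d → ℝ) (Ustar : Matrix (Fin d) (Fin r) ℝ),
        0 < lam → (∀ k, 0 < σ k) → SpikedCL.IsOrthonormalCols Ustar →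
        SpikedCL.condNumber σ < Cκ →
        c₁ ≤ SpikedCL.snr ν σ → SpikedCL.snr ν σ ≤ c₂ →
        SpikedCL.incoherence Ustar ≤ CI * (r * Real.log d / d) →
      ∀ (Ω : Type*) [MeasurableSpace Ω] (μ : Measure Ω) [IsProbabilityMeasure μ]
        (z : Fin n → Ω → Fin r → ℝ) (ξ : Fin n → Ω → Fin d → ℝ),
        SpikedCL.IsSpikedSample μ K ν σ z ξ →
      ∀ (W : Ω → Matrix (Fin r) (Fin d) ℝ) (U : Ω → Matrix (Fin d) (Fin r) ℝ)
        (s : Ω → Fin r → ℝ) (V : Ω → Matrix (Fin r) (Fin r) ℝ),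
        (∀ᵐ ω ∂μ, SpikedCL.IsCLSolution lam (SpikedCL.observed Ustar z ξ ω) (W ω)) →
        (∀ᵐ ω ∂μ, SpikedCL.IsSVD (W ω) (U ω) (s ω) (V ω)) →
        (∀ k j, AEMeasurable (fun ω => U ω k j) μ) →
        Integrable (fun ω => SpikedCL.sinTheta Ustar (U ω)) μ ∧
        ∫ ω, SpikedCL.sinTheta Ustar (U ω) ∂μ ≤
          C * ((r : ℝ) ^ (3 / 2 : ℝ) / d * Real.log d + Real.sqrt (d * r / n)) := by
  have hK : 0 < max K 1 := zero_lt_one.trans_le (le_max_right _ _)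
  set A : ℝ := 564 * (8 / 3 * (max K 1 * (1 + 1 / c₁ ^ 2))) with hA
  have hA0 : 0 < A := by positivity
  refine ⟨2 * A + 2 * |CI| + 1, by positivity, ?_⟩
  intro n d r hr hdn lam ν σ Us hlam hσ hUs _ hsnr _ hI Ω _ μ _ z ξ hsample W U sv V hW hSVD hU
  obtain ⟨hd, hσmax⟩ := SpikedCL.sigmaMax_pos_of_le_snr hc₁ hσ hsnr
  have hσν : c₁ * SpikedCL.sigmaMax σ ≤ ν := (le_div_iff₀ hσmax).1 hsnr
  have hν : 0 < ν := (mul_pos hc₁ hσmax).trans_le hσν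
  have hq : 0 < ν ^ 2 := by positivity
  have hσq : SpikedCL.sigmaMax σ ^ 2 ≤ 1 / c₁ ^ 2 * ν ^ 2 := by
    rw [one_div, inv_mul_eq_div, le_div_iff₀ (by positivity), mul_comm, ← mul_pow]
    exact pow_le_pow_left₀ (by positivity) hσν 2
  -- From `sigmaMax σ ≤ ν / c₁` both variances are at most a multiple of `ν²`. Taking `s`
  -- proportional to `1 / ν²` gives `564 / s = A * ν ^ 2`, so that `C` is free of `ν` and `σ`.
  set s : ℝ := 3 / 8 / (max K 1 * ((1 + 1 / c₁ ^ 2) * ν ^ 2)) with hs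
  have hs0 : 0 < s := by positivity
  have hsK : s * (max K 1 * (ν ^ 2 + SpikedCL.sigmaMax σ ^ 2)) ≤ 3 / 8 := by
    calc s * (max K 1 * (ν ^ 2 + SpikedCL.sigmaMax σ ^ 2))
        ≤ s * (max K 1 * ((1 + 1 / c₁ ^ 2) * ν ^ 2)) := by gcongr; linarith
      _ = 3 / 8 := div_mul_cancel₀ _ (by positivity)
  have hm : 0 ≤ SpikedCL.incoherence Us := (abs_nonneg _).trans
    (SpikedCL.abs_mul_transpose_apply_le_incoherence Us ⟨0, hd⟩)
  obtain ⟨F, hFint, hFle, hF⟩ := hsample.exists_bilinBound hUs hd hdn hs0 hsK hm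
    (SpikedCL.abs_mul_transpose_apply_le_incoherence Us)
  have hle : ∀ᵐ ω ∂μ, SpikedCL.sinTheta Us (U ω) ≤ √r * (2 / ν ^ 2) * F ω := by
    filter_upwards [hW, hSVD] with ω h1 h2
    refine (SpikedCL.sinTheta_le_of_isCLSolution (by omega) hlam hq hUs hd (hF ω) h1 h2).trans_eq ?_
    ring
  have hbound : Integrable (fun ω => √r * (2 / ν ^ 2) * F ω) μ := hFint.const_mul _
  have hint : Integrable (fun ω => SpikedCL.sinTheta Us (U ω)) μ := by
    refine hbound.mono' (SpikedCL.aemeasurable_sinTheta Us hU).aestronglyMeasurable ?_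
    filter_upwards [hle] with ω h
    rwa [Real.norm_of_nonneg (show 0 ≤ SpikedCL.sinTheta Us (U ω) from Real.sqrt_nonneg _)]
  refine ⟨hint, ?_⟩
  have hsA : 564 / s = A * ν ^ 2 := by
    rw [hs, hA]; field_simp
  calc ∫ ω, SpikedCL.sinTheta Us (U ω) ∂μ ≤ ∫ ω, √r * (2 / ν ^ 2) * F ω ∂μ :=
        integral_mono_ae hint hbound hle
    _ = √r * (2 / ν ^ 2) * ∫ ω, F ω ∂μ := integral_const_mul _ _
    _ ≤ √r * (2 / ν ^ 2) * (A * ν ^ 2 * √(d / n) + ν ^ 2 * SpikedCL.incoherence Us) := by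
        rw [← hsA]; gcongr
    _ ≤ _ := SpikedCL.sqrt_mul_rate_le hq hI hA0.le
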